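/- **The machine IMP2.** Let $\mathcal B_0,\mathcal B_1,\mathcal B_2,\dots$ be all binary strings in length-increasing lexicographic order ($\mathcal B_0=\epsilon$, $\mathcal B_1=\mathtt 0$, $\mathcal B_2=\mathtt 1$, $\mathcal B_3=\mathtt{00}$, …), let $\bar n=\mathtt 1^{|\mathcal B_n|}\cdot\mathtt 0\cdot\mathcal B_n$, and let $\langle n,y\rangle=\bar n\cdot y$ for $n\in\mathbb N$ and a binary string $y$. Sentences $P$, boolean expressions $B$ and arithmetic expressions $A$ are given by the grammar (with $N$ a natural number) $$\begin{aligned}P&\to \mathtt{skip}\mid \mathtt{x[}N\mathtt{]:=}A\mid(\mathtt{while}\ B\ \mathtt{do}\ P)\mid(P;P)\mid(\mathtt{if}\ B\ \mathtt{then}\ P\ \mathtt{else}\ P)\\ B&\to\mathtt{true}\mid\mathtt{false}\mid(A=A)\mid(A<A)\mid(B\ \mathtt{and}\ B)\mid(B\ \mathtt{or}\ B)\mid\mathtt{not}\ B\\ A&\to\mathtt{readbit}\mid N\mid\mathtt{x[}N\mathtt{]}\mid(A+A)\mid(A-A)\mid(A*A).\end{aligned}$$ A sentence is executed, with the usual meaning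 of its commands, on memory locations $\mathtt{x[0]},\mathtt{x[1]},\dots$ that hold arbitrarily large non-negative integers, initially $0$, and on an input stream of bits. Subtraction is truncated at $0$, expressions are evaluated from left to right, and the second argument of $\mathtt{and}$ / $\mathtt{or}$ is evaluated only when it is needed. The operation $\mathtt{readbit}$ returns the next unread bit of the input stream; if no bit is left, the execution never halts. Let $P_0,P_1,\dots$ be the following bijective enumeration of all sentences. In each syntactic category the finite alternatives come first, and the other production rules then alternate in the order of the grammar. The arguments of a rule are combined by Cantor's tupling functions $(x,y)\mapsto x+\binom{x+y+1}{2}$ and $(x,y,z)\mapsto x+\binom{x+y+1}{2}+\binom{x+y+z+2}{3}$. So, for $k\ge 0$, position $0$ of $A$ is $\mathtt{readbit}$ and the positions $5k+1,\dots,5k+5$ belong to the other five rules for $A$; positions $0,1$ of $B$ are $\mathtt{true},\mathtt{false}$ and the positions $5k+2,\dots,5k+6$ belong to the other five rules for $B$; position $0$ of $P$ is $\mathtt{skip}$ and the positions $4k+1,\dots,4k+4$ belong to the other four rules for $P$; here $k$ is the code of the arguments. Write $P(y)=x$ if $P$, started with all memory locations $0$ and input stream $y$, halts after reading exactly all the bits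 of $y$, and $x=\mathcal B_{\mathtt{x[0]}}\cdot\mathcal B_{\mathtt{x[1]}}\cdots$ for the final contents of the memory locations; otherwise $P(y)$ is undefined. IMP2 is the partial function on binary strings with $\mathrm{IMP2}(\langle n,y\rangle)=P_n(y)$, undefined on strings that are not of the form $\langle n,y\rangle$. **Definitions.** A *prefix machine* is a partial computable function $G$ from binary strings to binary strings whose domain is prefix-free (no element of it is a proper prefix of another one). Put $K_G(x)=\min\{|p| : G(p)=x\}$, with $K_G(x)=\infty$ if there is no such $p$. A machine $U$ is *additively optimal* for a class of machines if it belongs to the class and for every machine $G$ of the class there is a constant $c$, independent of $x$, with $K_U(x)\le K_G(x)+c$ for all $x$. **Proposition.** IMP2 is additively optimal for the class of prefix machines; in particular, it is a prefix machine. Moreover, for every prefix machine $G$ there is an $n$ with $\mathrm{IMP2}(\langle n,y\rangle)=P_n(y)=G(y)$ for every binary string $y$ (both sides may be undefined), and for every $n$ such that $P_n(y)=G(y)$ for all $y$, $$K_{\mathrm{IMP2}}(x)\le K_G(x)+2|\mathcal B_n|+1\quad\text{for all binary strings }x.$$ -/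

import Mathlib

namespace Imp2

/-! ### Binary strings and two-part codes -/

/-- The `n`-th binary string `B_n` in the length-increasing lexicographic enumeration
`ε, 0, 1, 00, 01, 10, 11, …` (`false` is the bit 0, `true` is the bit 1): the successors of a
string `B_k` by one bit are `B_(2k+1) = B_k · 0` and `B_(2k+2) = B_k · 1`. -/
def bstr : ℕ → List Bool
  | 0 => []
  | n + 1 => bstr (n / 2) ++ [decide (n % 2 = 1)]
decreasing_by omega

/-- The self-delimiting code `1^|B_n| · 0 · B_n` of `n`. -/
def selfDelim (n : ℕ) : List Bool :=
  List.replicate (bstr n).length true ++ false :: bstr n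

/-- The two-part code `⟨n, y⟩`. -/
def twoPart (n : ℕ) (y : List Bool) : List Bool :=
  selfDelim n ++ y

/-! ### Syntax -/

/-- Arithmetic expressions. -/
inductive AExp : Type
  | readbit : AExp
  | num (n : ℕ) : AExp
  | loc (n : ℕ) : AExp
  | add (a₁ a₂ : AExp) : AExp
  | sub (a₁ a₂ : AExp) : AExp
  | mul (a₁ a₂ : AExp) : AExp

/-- Boolean expressions. -/
inductive BExp : Type
  | tt : BExp
  | ff : BExp
  | eq (a₁ a₂ : AExp) : BExp
  | lt (a₁ a₂ : AExp) : BExp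
  | and (b₁ b₂ : BExp) : BExp
  | or (b₁ b₂ : BExp) : BExp
  | not (b : BExp) : BExp

/-- Sentences of the language. -/
inductive Sentence : Type
  | skip : Sentence
  | assign (n : ℕ) (a : AExp) : Sentence
  | whileDo (b : BExp) (P : Sentence) : Sentence
  | seq (P₁ P₂ : Sentence) : Sentence
  | ite (b : BExp) (P₁ P₂ : Sentence) : Sentence

/-! ### Semantics -/

/-- A state: the contents of the memory locations and the unread part of the input stream. -/
structure State : Type where
  mem : ℕ → ℕ
  input : List Bool

/-- Evaluation of arithmetic expressions, from left to right. The value is `none` if a bit is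
requested from an empty input stream (the machine then loops forever). Subtraction of
non-negative integers is truncated at `0`. -/
def AExp.eval : AExp → State → Option (ℕ × State)
  | readbit, s =>
    match s.input with
    | [] => none
    | b :: y => some (b.toNat, ⟨s.mem, y⟩)
  | num n, s => some (n, s)
  | loc n, s => some (s.mem n, s)
  | add a₁ a₂, s => do
    let (v₁, s₁) ← a₁.eval s
    let (v₂, s₂) ← a₂.eval s₁
    return (v₁ + v₂, s₂)
  | sub a₁ a₂, s => do
    let (v₁, s₁) ← a₁.eval s
    let (v₂, s₂) ← a₂.eval s₁
    return (v₁ - v₂, s₂)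
  | mul a₁ a₂, s => do
    let (v₁, s₁) ← a₁.eval s
    let (v₂, s₂) ← a₂.eval s₁
    return (v₁ * v₂, s₂)

/-- Evaluation of boolean expressions, from left to right; the second argument of a conjunction
(disjunction) is evaluated only if the first one is true (false). -/
def BExp.eval : BExp → State → Option (Bool × State)
  | tt, s => some (true, s)
  | ff, s => some (false, s)
  | eq a₁ a₂, s => do
    let (v₁, s₁) ← a₁.eval s
    let (v₂, s₂) ← a₂.eval s₁
    return (decide (v₁ = v₂), s₂)
  | lt a₁ a₂, s => do
    let (v₁, s₁) ← a₁.eval s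
    let (v₂, s₂) ← a₂.eval s₁
    return (decide (v₁ < v₂), s₂)
  | and b₁ b₂, s => do
    let (v₁, s₁) ← b₁.eval s
    if v₁ then b₂.eval s₁ else return (false, s₁)
  | or b₁ b₂, s => do
    let (v₁, s₁) ← b₁.eval s
    if v₁ then return (true, s₁) else b₂.eval s₁
  | not b, s => do
    let (v, s₁) ← b.eval s
    return (!v, s₁)

/-- `Exec P s t`: the execution of `P` from the state `s` halts in the state `t`. -/
inductive Exec : Sentence → State → State → Prop
  | skip (s : State) : Exec .skip s s
  | assign {n : ℕ} {a : AExp} {s s₁ : State} {v : ℕ} (ha : a.eval s = some (v, s₁)) :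
      Exec (.assign n a) s ⟨Function.update s₁.mem n v, s₁.input⟩
  | while_true {b : BExp} {P : Sentence} {s s₁ s₂ s₃ : State} (hb : b.eval s = some (true, s₁))
      (hP : Exec P s₁ s₂) (hw : Exec (.whileDo b P) s₂ s₃) : Exec (.whileDo b P) s s₃
  | while_false {b : BExp} {P : Sentence} {s s₁ : State} (hb : b.eval s = some (false, s₁)) :
      Exec (.whileDo b P) s s₁
  | seq {P₁ P₂ : Sentence} {s s₁ s₂ : State} (h₁ : Exec P₁ s s₁) (h₂ : Exec P₂ s₁ s₂) :
      Exec (.seq P₁ P₂) s s₂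
  | ite_true {b : BExp} {P₁ P₂ : Sentence} {s s₁ s₂ : State} (hb : b.eval s = some (true, s₁))
      (hP : Exec P₁ s₁ s₂) : Exec (.ite b P₁ P₂) s s₂
  | ite_false {b : BExp} {P₁ P₂ : Sentence} {s s₁ s₂ : State} (hb : b.eval s = some (false, s₁))
      (hP : Exec P₂ s₁ s₂) : Exec (.ite b P₁ P₂) s s₂

/-- `MemOutput σ x`: the string `x` is the concatenation `B_σ(0) · B_σ(1) · …` over all memory
locations, where all but finitely many locations contain `0` and so contribute `B_0 = ε`. -/
def MemOutput (σ : ℕ → ℕ) (x : List Bool) : Prop :=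
  ∃ m : ℕ, (∀ i, m ≤ i → σ i = 0) ∧ x = (List.range m).flatMap fun i => bstr (σ i)

/-- `P.Outputs y x`: started with all memory locations `0` and with input stream `y`, the
sentence `P` halts after reading exactly all the bits of `y`, with output `x`. -/
def Sentence.Outputs (P : Sentence) (y x : List Bool) : Prop :=
  ∃ σ : ℕ → ℕ, Exec P ⟨fun _ => 0, y⟩ ⟨σ, []⟩ ∧ MemOutput σ x

theorem Exec.det {P : Sentence} {s t t' : State} (h : Exec P s t) (h' : Exec P s t') :
    t = t' := by
  induction h generalizing t' with
  | skip s => cases h'; rfl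
  | assign ha => cases h' with | assign ha' => simp_all
  | while_true hb _ _ ih₁ ih₂ =>
    cases h' with
    | while_true hb' h₁ h₂ =>
      have := hb.symm.trans hb'
      simp only [Option.some.injEq, Prod.mk.injEq, true_and] at this
      subst this
      have := ih₁ h₁
      subst this
      exact ih₂ h₂
    | while_false hb' => simp_all
  | while_false hb =>
    cases h' with
    | while_true hb' h₁ h₂ => simp_all
    | while_false hb' => simp_all
  | seq _ _ ih₁ ih₂ =>
    cases h' with
    | seq h₁ h₂ =>
      have := ih₁ h₁
      subst this
      exact ih₂ h₂
  | ite_true hb _ ih =>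
    cases h' with
    | ite_true hb' h₁ =>
      have := hb.symm.trans hb'
      simp only [Option.some.injEq, Prod.mk.injEq, true_and] at this
      subst this
      exact ih h₁
    | ite_false hb' h₁ => simp_all
  | ite_false hb _ ih =>
    cases h' with
    | ite_true hb' h₁ => simp_all
    | ite_false hb' h₁ =>
      have := hb.symm.trans hb'
      simp only [Option.some.injEq, Prod.mk.injEq, true_and] at this
      subst this
      exact ih h₁

theorem bstr_zero : bstr 0 = [] := by simp [bstr]

theorem MemOutput.unique {σ : ℕ → ℕ} {x x' : List Bool} (h : MemOutput σ x)
    (h' : MemOutput σ x') : x = x' := by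
  have key : ∀ m k : ℕ, (∀ i, m ≤ i → σ i = 0) →
      (List.range (m + k)).flatMap (fun i => bstr (σ i)) =
        (List.range m).flatMap fun i => bstr (σ i) := by
    intro m k hm
    induction k with
    | zero => rfl
    | succ k ih =>
      rw [← Nat.add_assoc, List.range_succ, List.flatMap_append, ih]
      simp [hm (m + k) (by omega), bstr_zero]
  obtain ⟨m, hm, rfl⟩ := h
  obtain ⟨m', hm', rfl⟩ := h'
  rcases Nat.le_total m m' with hle | hle
  · obtain ⟨k, rfl⟩ := Nat.exists_eq_add_of_le hle
    exact (key m k hm).symm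
  · obtain ⟨k, rfl⟩ := Nat.exists_eq_add_of_le hle
    exact key m' k hm'

theorem Sentence.Outputs.unique {P : Sentence} {y x x' : List Bool} (h : P.Outputs y x)
    (h' : P.Outputs y x') : x = x' := by
  obtain ⟨σ, he, ho⟩ := h
  obtain ⟨σ', he', ho'⟩ := h'
  have := he.det he'
  simp only [State.mk.injEq, and_true] at this
  subst this
  exact ho.unique ho'

/-- The partial function `y ↦ P(y)` computed by a sentence `P`. -/
noncomputable def Sentence.run (P : Sentence) : List Bool →. List Bool :=
  fun y => ⟨∃ x, P.Outputs y x, fun h => h.choose⟩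

theorem Sentence.mem_run {P : Sentence} {y x : List Bool} : x ∈ P.run y ↔ P.Outputs y x :=
  ⟨fun ⟨h, e⟩ => e ▸ h.choose_spec, fun h => ⟨⟨x, h⟩, Exists.choose_spec ⟨x, h⟩ |>.unique h⟩⟩

/-! ### Enumeration of the sentences -/

/-- Cantor's pairing function. -/
def pair (x y : ℕ) : ℕ := x + (x + y + 1).choose 2

/-- Cantor's tupling function for triples. -/
def triple (x y z : ℕ) : ℕ := x + (x + y + 1).choose 2 + (x + y + z + 2).choose 3

/-- Position of an arithmetic expression: `readbit` comes first, and then the other five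
production rules alternate. -/
def AExp.rank : AExp → ℕ
  | readbit => 0
  | num n => 5 * n + 1
  | loc n => 5 * n + 2
  | add a₁ a₂ => 5 * pair a₁.rank a₂.rank + 3
  | sub a₁ a₂ => 5 * pair a₁.rank a₂.rank + 4
  | mul a₁ a₂ => 5 * pair a₁.rank a₂.rank + 5

/-- Position of a boolean expression. -/
def BExp.rank : BExp → ℕ
  | tt => 0
  | ff => 1
  | eq a₁ a₂ => 5 * pair a₁.rank a₂.rank + 2
  | lt a₁ a₂ => 5 * pair a₁.rank a₂.rank + 3
  | and b₁ b₂ => 5 * pair b₁.rank b₂.rank + 4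
  | or b₁ b₂ => 5 * pair b₁.rank b₂.rank + 5
  | not b => 5 * b.rank + 6

/-- Position of a sentence. -/
def Sentence.rank : Sentence → ℕ
  | skip => 0
  | assign n a => 4 * pair n a.rank + 1
  | .whileDo b P => 4 * pair b.rank P.rank + 2
  | seq P₁ P₂ => 4 * pair P₁.rank P₂.rank + 3
  | ite b P₁ P₂ => 4 * triple b.rank P₁.rank P₂.rank + 4

/-- Uniqueness of the shell of a number, for a sequence of shells with sizes `g`. -/
theorem shell_unique {f g : ℕ → ℕ} (hf : ∀ n, f (n + 1) = f n + g n) {s s' r r' : ℕ}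
    (hr : r < g s) (hr' : r' < g s') (h : r + f s = r' + f s') : s = s' ∧ r = r' := by
  have mono : Monotone f := monotone_nat_of_le_succ fun n => by rw [hf]; omega
  have hs : s = s' := by
    rcases Nat.lt_trichotomy s s' with h1 | h1 | h1
    · have := mono (Nat.succ_le_of_lt h1)
      have := hf s
      simp only [Nat.succ_eq_add_one] at *
      omega
    · exact h1
    · have := mono (Nat.succ_le_of_lt h1)
      have := hf s'
      simp only [Nat.succ_eq_add_one] at *
      omega
  subst hs
  exact ⟨rfl, by omega⟩

/-- Existence of the shell of a number. -/
theorem shell_exists {f g : ℕ → ℕ} (hf : ∀ n, f (n + 1) = f n + g n) (h0 : f 0 = 0)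
    (hg : ∀ n, 0 < g n) (n : ℕ) : ∃ s r, r < g s ∧ r + f s = n := by
  induction n with
  | zero => exact ⟨0, 0, hg 0, by omega⟩
  | succ n ih =>
    obtain ⟨s, r, hr, h⟩ := ih
    by_cases hlt : r + 1 < g s
    · exact ⟨s, r + 1, hlt, by omega⟩
    · exact ⟨s + 1, 0, hg _, by rw [hf]; omega⟩

theorem choose_two_step (n : ℕ) : (n + 1 + 1).choose 2 = (n + 1).choose 2 + (n + 1) := by
  rw [Nat.choose_succ_succ' (n + 1) 1, Nat.choose_one_right, Nat.add_comm]

theorem choose_three_step (n : ℕ) :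
    (n + 1 + 2).choose 3 = (n + 2).choose 3 + (n + 2).choose 2 := by
  rw [Nat.choose_succ_succ' (n + 2) 2, Nat.add_comm]

theorem pair_inj {x y x' y' : ℕ} (h : pair x y = pair x' y') : x = x' ∧ y = y' := by
  have := shell_unique (f := fun n => (n + 1).choose 2) (g := fun n => n + 1) choose_two_step
    (s := x + y) (s' := x' + y') (r := x) (r' := x') (by simp) (by simp) h
  omega

theorem pair_surj (n : ℕ) : ∃ x y, pair x y = n := by
  obtain ⟨s, r, hr, h⟩ := shell_exists (f := fun n => (n + 1).choose 2) (g := fun n => n + 1)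
    choose_two_step (by simp) (by simp) n
  refine ⟨r, s - r, ?_⟩
  rw [pair, show r + (s - r) = s by omega]
  exact h

theorem pair_lt (x y z : ℕ) : pair x y < (x + y + z + 2).choose 2 := by
  have h1 : pair x y < (x + y + 2).choose 2 := by
    have h2 : (x + y + 2).choose 2 = _ := choose_two_step (x + y)
    simp only [pair]
    omega
  exact h1.trans_le (Nat.choose_le_choose 2 (by omega))

theorem triple_inj {x y z x' y' z' : ℕ} (h : triple x y z = triple x' y' z') :
    x = x' ∧ y = y' ∧ z = z' := by
  have := shell_unique (f := fun n => (n + 2).choose 3) (g := fun n => (n + 2).choose 2)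
    choose_three_step (s := x + y + z) (s' := x' + y' + z') (pair_lt x y z) (pair_lt x' y' z') h
  have := pair_inj this.2
  omega

theorem triple_surj (n : ℕ) : ∃ x y z, triple x y z = n := by
  obtain ⟨s, r, hr, h⟩ := shell_exists (f := fun n => (n + 2).choose 3)
    (g := fun n => (n + 2).choose 2) choose_three_step (by simp)
    (fun n => Nat.choose_pos (by omega)) n
  obtain ⟨x, y, rfl⟩ := pair_surj r
  have hle : x + y ≤ s := by
    by_contra hlt
    have h1 : (s + 2).choose 2 ≤ (x + y + 1).choose 2 := Nat.choose_le_choose 2 (by omega)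
    simp only [pair] at hr
    omega
  refine ⟨x, y, s - (x + y), ?_⟩
  rw [triple, show x + y + (s - (x + y)) = s by omega]
  exact h

theorem le_pair (x y : ℕ) : x ≤ pair x y ∧ y ≤ pair x y := by
  have h : (x + y + 1).choose 2 = (x + y).choose 1 + (x + y).choose 2 :=
    Nat.choose_succ_succ' (x + y) 1
  rw [Nat.choose_one_right] at h
  simp only [pair]
  omega

theorem le_triple (x y z : ℕ) : x ≤ triple x y z ∧ y ≤ triple x y z ∧ z ≤ triple x y z := by
  have h := le_pair x y
  have h2 : (x + y + z + 2).choose 3 = (x + y + z + 1).choose 2 + (x + y + z + 1).choose 3 :=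
    Nat.choose_succ_succ' (x + y + z + 1) 2
  have h3 : (x + y + z + 1).choose 2 = (x + y + z).choose 1 + (x + y + z).choose 2 :=
    Nat.choose_succ_succ' (x + y + z) 1
  rw [Nat.choose_one_right] at h3
  simp only [pair] at h
  simp only [triple]
  omega

theorem cancel {k c u v : ℕ} (hk : 0 < k) (h : k * u + c = k * v + c) : u = v :=
  Nat.eq_of_mul_eq_mul_left hk (Nat.add_right_cancel h)

theorem AExp.rank_injective : Function.Injective AExp.rank := by
  intro a
  induction a with
  | readbit => intro a' h; cases a' <;> simp only [rank] at h <;> first | rfl | omega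
  | num n => intro a' h; cases a' <;> simp only [rank] at h <;> first | omega | (congr 1; omega)
  | loc n => intro a' h; cases a' <;> simp only [rank] at h <;> first | omega | (congr 1; omega)
  | add a₁ a₂ ih₁ ih₂ | sub a₁ a₂ ih₁ ih₂ | mul a₁ a₂ ih₁ ih₂ =>
    intro a' h
    cases a' <;> simp only [rank] at h <;> first
      | omega
      | (have h' := pair_inj (cancel (by norm_num) h)
         rw [ih₁ h'.1, ih₂ h'.2])

theorem BExp.rank_injective : Function.Injective BExp.rank := by
  intro b
  induction b with
  | tt => intro b' h; cases b' <;> simp only [rank] at h <;> first | rfl | omega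
  | ff => intro b' h; cases b' <;> simp only [rank] at h <;> first | rfl | omega
  | eq a₁ a₂ | lt a₁ a₂ =>
    intro b' h
    cases b' <;> simp only [rank] at h <;> first
      | omega
      | (have h' := pair_inj (cancel (by norm_num) h)
         rw [AExp.rank_injective h'.1, AExp.rank_injective h'.2])
  | and b₁ b₂ ih₁ ih₂ | or b₁ b₂ ih₁ ih₂ =>
    intro b' h
    cases b' <;> simp only [rank] at h <;> first
      | omega
      | (have h' := pair_inj (cancel (by norm_num) h)
         rw [ih₁ h'.1, ih₂ h'.2])
  | not b ih =>
    intro b' h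
    cases b' <;> simp only [rank] at h <;> first
      | omega
      | (rw [ih (cancel (by norm_num) h)])

theorem Sentence.rank_injective : Function.Injective Sentence.rank := by
  intro P
  induction P with
  | skip => intro P' h; cases P' <;> simp only [rank] at h <;> first | rfl | omega
  | assign n a =>
    intro P' h
    cases P' <;> simp only [rank] at h <;> first
      | omega
      | (have h' := pair_inj (cancel (by norm_num) h)
         rw [h'.1, AExp.rank_injective h'.2])
  | whileDo b P ih =>
    intro P' h
    cases P' <;> simp only [rank] at h <;> first
      | omega
      | (have h' := pair_inj (cancel (by norm_num) h)
         rw [BExp.rank_injective h'.1, ih h'.2])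
  | seq P₁ P₂ ih₁ ih₂ =>
    intro P' h
    cases P' <;> simp only [rank] at h <;> first
      | omega
      | (have h' := pair_inj (cancel (by norm_num) h)
         rw [ih₁ h'.1, ih₂ h'.2])
  | ite b P₁ P₂ ih₁ ih₂ =>
    intro P' h
    cases P' <;> simp only [rank] at h <;> first
      | omega
      | (have h' := triple_inj (cancel (by norm_num) h)
         rw [BExp.rank_injective h'.1, ih₁ h'.2.1, ih₂ h'.2.2])

theorem AExp.rank_surjective : Function.Surjective AExp.rank := by
  intro k
  induction k using Nat.strong_induction_on with
  | _ k ih =>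
    rcases Nat.eq_zero_or_pos k with rfl | hk
    · exact ⟨readbit, rfl⟩
    · obtain ⟨x, y, hxy⟩ := pair_surj ((k - 1) / 5)
      have hle := le_pair x y
      have h5 : (k - 1) % 5 = 0 ∨ (k - 1) % 5 = 1 ∨ (k - 1) % 5 = 2 ∨ (k - 1) % 5 = 3 ∨
        (k - 1) % 5 = 4 := by omega
      rcases h5 with h | h | h | h | h
      · exact ⟨num ((k - 1) / 5), by simp only [rank]; omega⟩
      · exact ⟨loc ((k - 1) / 5), by simp only [rank]; omega⟩
      all_goals
        obtain ⟨a₁, h₁⟩ := ih x (by omega)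
        obtain ⟨a₂, h₂⟩ := ih y (by omega)
      · exact ⟨add a₁ a₂, by simp only [rank, h₁, h₂]; omega⟩
      · exact ⟨sub a₁ a₂, by simp only [rank, h₁, h₂]; omega⟩
      · exact ⟨mul a₁ a₂, by simp only [rank, h₁, h₂]; omega⟩

theorem BExp.rank_surjective : Function.Surjective BExp.rank := by
  intro k
  induction k using Nat.strong_induction_on with
  | _ k ih =>
    rcases Nat.lt_or_ge k 2 with hk | hk
    · rcases (show k = 0 ∨ k = 1 by omega) with rfl | rfl
      · exact ⟨tt, rfl⟩
      · exact ⟨ff, rfl⟩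
    · obtain ⟨x, y, hxy⟩ := pair_surj ((k - 2) / 5)
      have hle := le_pair x y
      obtain ⟨c₁, e₁⟩ := AExp.rank_surjective x
      obtain ⟨c₂, e₂⟩ := AExp.rank_surjective y
      obtain ⟨b₁, h₁⟩ := ih x (by omega)
      obtain ⟨b₂, h₂⟩ := ih y (by omega)
      have h5 : (k - 2) % 5 = 0 ∨ (k - 2) % 5 = 1 ∨ (k - 2) % 5 = 2 ∨ (k - 2) % 5 = 3 ∨
        (k - 2) % 5 = 4 := by omega
      rcases h5 with h | h | h | h | h
      · exact ⟨eq c₁ c₂, by simp only [rank, e₁, e₂]; omega⟩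
      · exact ⟨lt c₁ c₂, by simp only [rank, e₁, e₂]; omega⟩
      · exact ⟨and b₁ b₂, by simp only [rank, h₁, h₂]; omega⟩
      · exact ⟨or b₁ b₂, by simp only [rank, h₁, h₂]; omega⟩
      · obtain ⟨b, hb⟩ := ih ((k - 2) / 5) (by omega)
        exact ⟨not b, by simp only [rank, hb]; omega⟩

theorem Sentence.rank_surjective : Function.Surjective Sentence.rank := by
  intro k
  induction k using Nat.strong_induction_on with
  | _ k ih =>
    rcases Nat.eq_zero_or_pos k with rfl | hk
    · exact ⟨skip, rfl⟩
    · obtain ⟨x, y, hxy⟩ := pair_surj ((k - 1) / 4)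
      have hle := le_pair x y
      obtain ⟨a, ha⟩ := AExp.rank_surjective y
      obtain ⟨b, hb⟩ := BExp.rank_surjective x
      obtain ⟨P₁, h₁⟩ := ih x (by omega)
      obtain ⟨P₂, h₂⟩ := ih y (by omega)
      have h4 : (k - 1) % 4 = 0 ∨ (k - 1) % 4 = 1 ∨ (k - 1) % 4 = 2 ∨ (k - 1) % 4 = 3 := by
        omega
      rcases h4 with h | h | h | h
      · exact ⟨assign x a, by simp only [rank, ha]; omega⟩
      · exact ⟨.whileDo b P₂, by simp only [rank, hb, h₂]; omega⟩
      · exact ⟨seq P₁ P₂, by simp only [rank, h₁, h₂]; omega⟩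
      · obtain ⟨u, v, w, huvw⟩ := triple_surj ((k - 1) / 4)
        have hle' := le_triple u v w
        obtain ⟨c, hc⟩ := BExp.rank_surjective u
        obtain ⟨Q₁, e₁⟩ := ih v (by omega)
        obtain ⟨Q₂, e₂⟩ := ih w (by omega)
        exact ⟨ite c Q₁ Q₂, by simp only [rank, hc, e₁, e₂]; omega⟩

/-- The `n`-th sentence `P_n` in the enumeration of all sentences. -/
noncomputable def sentence : ℕ ≃ Sentence :=
  (Equiv.ofBijective Sentence.rank ⟨Sentence.rank_injective, Sentence.rank_surjective⟩).symm

/-! ### The machine -/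

theorem bstr_injective : Function.Injective bstr := by
  intro m
  induction m using Nat.strong_induction_on with
  | _ m ih =>
    intro n h
    cases m with
    | zero => cases n with
      | zero => rfl
      | succ n => simp [bstr] at h
    | succ m => cases n with
      | zero => simp [bstr] at h
      | succ n =>
        rw [bstr, bstr] at h
        obtain ⟨h1, h2⟩ := List.append_inj' h rfl
        have h3 := ih (m / 2) (by omega) h1
        simp only [List.cons.injEq, and_true, decide_eq_decide] at h2
        omega

theorem replicate_inj {k l : ℕ} {u v : List Bool}
    (h : List.replicate k true ++ false :: u = List.replicate l true ++ false :: v) :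
    k = l ∧ u = v := by
  induction k generalizing l with
  | zero => cases l with
    | zero => simpa using h
    | succ l => simp [List.replicate_succ] at h
  | succ k ih => cases l with
    | zero => simp [List.replicate_succ] at h
    | succ l =>
      simp only [List.replicate_succ, List.cons_append, List.cons.injEq, true_and] at h
      have := ih h
      exact ⟨by omega, this.2⟩

theorem twoPart_inj {m n : ℕ} {y z : List Bool} (h : twoPart m y = twoPart n z) :
    m = n ∧ y = z := by
  simp only [twoPart, selfDelim, List.append_assoc, List.cons_append] at h
  obtain ⟨h1, h2⟩ := replicate_inj h
  obtain ⟨h3, h4⟩ := List.append_inj h2 h1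
  exact ⟨bstr_injective h3, h4⟩

/-- The machine IMP2 halts on the input `p` with output `x`: `p` is a two-part code `⟨n, y⟩`, and
the sentence `P_n`, executed with input stream `y`, halts after reading exactly all the bits of
`y`, with output `x`. -/
def Outputs (p x : List Bool) : Prop :=
  ∃ (n : ℕ) (y : List Bool), p = twoPart n y ∧ (sentence n).Outputs y x

theorem Outputs.unique {p x x' : List Bool} (h : Outputs p x) (h' : Outputs p x') :
    x = x' := by
  obtain ⟨n, y, rfl, h⟩ := h
  obtain ⟨n', y', e, h'⟩ := h'
  obtain ⟨rfl, rfl⟩ := twoPart_inj e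
  exact h.unique h'

/-- The machine IMP2, as a partial function on binary strings. -/
noncomputable def machine : List Bool →. List Bool :=
  fun p => ⟨∃ x, Outputs p x, fun h => h.choose⟩

theorem mem_machine {p x : List Bool} : x ∈ machine p ↔ Outputs p x :=
  ⟨fun ⟨h, e⟩ => e ▸ h.choose_spec, fun h => ⟨⟨x, h⟩, Exists.choose_spec ⟨x, h⟩ |>.unique h⟩⟩

end Imp2

/-! ### Prefix machines and prefix complexity -/

/-- A prefix machine: a partial computable function on binary strings whose domain, the set of
halting programs, is prefix-free. -/
structure IsPrefixMachine (G : List Bool →. List Bool) : Prop where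
  partrec : Partrec G
  prefixFree : ∀ p ∈ G.Dom, ∀ q ∈ G.Dom, p <+: q → p = q

/-- The complexity `K_U(x) = min {|p| : U(p) = x}`, equal to `∞` if `U` has no program for `x`. -/
noncomputable def complexity (U : List Bool →. List Bool) (x : List Bool) : ℕ∞ :=
  ⨅ (p : List Bool) (_ : x ∈ U p), (p.length : ℕ∞)

/-- `U` is additively optimal for the class `C` of machines: it belongs to `C`, and for every
machine `G` in `C` there is a constant `c` with `K_U(x) ≤ K_G(x) + c` for all `x`. -/
def AdditivelyOptimal (U : List Bool →. List Bool) (C : Set (List Bool →. List Bool)) : Prop :=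
  U ∈ C ∧ ∀ G ∈ C, ∃ c : ℕ, ∀ x : List Bool, complexity U x ≤ complexity G x + c

/-! IMP2 is a prefix machine. Its domain is prefix-free because an execution that consumes exactly
`y` also runs on `y ++ z` and leaves `z` unread (`Exec.extend`). By determinism, a halting execution
with input `y ++ z` that reads everything forces `z = []` (`machine_prefixFree`). It is partial
recursive because the big-step semantics is simulated by an interpreter on the codes of expressions.
The recursion of the interpreter is bounded by a depth `k`, it is computable by Kleene's recursion
theorem (`Evaluator.computable_evaln`), and a search over `n`, `y`, `k` finds a halting run
(`partrec_machine`).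

Conversely, let `G` be a prefix machine. A sentence receives no end-of-input signal, so it must know
when to stop reading. Prefix-freeness supplies this: the string `s` read so far cannot both lie in
the domain and have a proper extension there. So dovetailing the computations of `G` gives a partial
recursive look-ahead, which on `s` either returns the value `G s` or orders another bit to be read
(`exists_lookahead`). Every partial recursive function on numbers is computed by a sentence that
reads no bits, by induction on its construction from `Nat.Partrec` (`exists_realizes`). A loop that
alternates look-ahead and `readbit` then computes `G` (`exists_sentence`).

The inequality is the length count for two-part codes: if `P_n` computes `G` and `G p = x`, then
`⟨n, p⟩` is an IMP2-program for `x` with `2 |B_n| + 1` additional bits (`complexity_machine_le`). -/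

namespace Imp2

/-! ### The machine is prefix-free -/

/-- The state `s` with the bits `z` appended to the unread input. -/
def State.extend (s : State) (z : List Bool) : State := ⟨s.mem, s.input ++ z⟩

/-- The only test on the input is whether it is empty, and that test can only block an evaluation.
Hence further bits at the end never alter a successful one. -/
theorem AExp.eval_extend {a : AExp} {s t : State} {v : ℕ} (h : a.eval s = some (v, t))
    (z : List Bool) : a.eval (s.extend z) = some (v, t.extend z) := by
  induction a generalizing s t v with
  | readbit =>
    rcases s with ⟨m, _ | ⟨b, y⟩⟩ <;> simp [AExp.eval, State.extend] at h ⊢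
    obtain ⟨rfl, rfl⟩ := h
    simp
  | num n => simp_all [AExp.eval, State.extend]
  | loc n =>
    simp only [AExp.eval, Option.some.injEq, Prod.mk.injEq] at h ⊢
    obtain ⟨rfl, rfl⟩ := h
    exact ⟨rfl, rfl⟩
  | add a₁ a₂ ih₁ ih₂ | sub a₁ a₂ ih₁ ih₂ | mul a₁ a₂ ih₁ ih₂ =>
    simp only [AExp.eval, Option.bind_eq_bind, Option.bind_eq_some_iff, Prod.exists] at h ⊢
    obtain ⟨v₁, s₁, h₁, v₂, s₂, h₂, h⟩ := h
    simp only [Option.pure_def, Option.some.injEq, Prod.mk.injEq] at h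
    obtain ⟨rfl, rfl⟩ := h
    exact ⟨v₁, _, ih₁ h₁, v₂, _, ih₂ h₂, rfl⟩

theorem BExp.eval_extend {b : BExp} {s t : State} {v : Bool} (h : b.eval s = some (v, t))
    (z : List Bool) : b.eval (s.extend z) = some (v, t.extend z) := by
  induction b generalizing s t v with
  | tt => simp_all [BExp.eval]
  | ff => simp_all [BExp.eval]
  | eq a₁ a₂ | lt a₁ a₂ =>
    simp only [BExp.eval, Option.bind_eq_bind, Option.bind_eq_some_iff, Prod.exists] at h ⊢
    obtain ⟨v₁, s₁, h₁, v₂, s₂, h₂, h⟩ := h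
    simp only [Option.pure_def, Option.some.injEq, Prod.mk.injEq] at h
    obtain ⟨rfl, rfl⟩ := h
    exact ⟨v₁, _, AExp.eval_extend h₁ z, v₂, _, AExp.eval_extend h₂ z, rfl⟩
  | and b₁ b₂ ih₁ ih₂ | or b₁ b₂ ih₁ ih₂ =>
    simp only [BExp.eval, Option.bind_eq_bind, Option.bind_eq_some_iff, Prod.exists] at h ⊢
    obtain ⟨v₁, s₁, h₁, h⟩ := h
    refine ⟨v₁, _, ih₁ h₁, ?_⟩
    cases v₁ <;> simp at h ⊢ <;> first | exact ih₂ h | (obtain ⟨rfl, rfl⟩ := h; simp)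
  | not b ih =>
    simp only [BExp.eval, Option.bind_eq_bind, Option.bind_eq_some_iff, Prod.exists] at h ⊢
    obtain ⟨v₁, s₁, h₁, h⟩ := h
    simp only [Option.pure_def, Option.some.injEq, Prod.mk.injEq] at h
    obtain ⟨rfl, rfl⟩ := h
    exact ⟨v₁, _, ih h₁, rfl⟩

theorem Exec.extend {P : Sentence} {s t : State} (h : Exec P s t) (z : List Bool) :
    Exec P (s.extend z) (t.extend z) := by
  induction h with
  | skip s => exact .skip _
  | assign ha => exact .assign (AExp.eval_extend ha z)
  | while_true hb _ _ ih₁ ih₂ => exact .while_true (BExp.eval_extend hb z) ih₁ ih₂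
  | while_false hb => exact .while_false (BExp.eval_extend hb z)
  | seq _ _ ih₁ ih₂ => exact .seq ih₁ ih₂
  | ite_true hb _ ih => exact .ite_true (BExp.eval_extend hb z) ih
  | ite_false hb _ ih => exact .ite_false (BExp.eval_extend hb z) ih

/-- Unique parsing gives both programs the same `n`, and the second input is `y ++ z`. The run on
`y`, extended by `z`, leaves `z` unread, while the actual run on `y ++ z` leaves nothing. -/
theorem machine_prefixFree : ∀ p ∈ machine.Dom, ∀ q ∈ machine.Dom, p <+: q → p = q := by
  rintro _ ⟨x, n, y, rfl, σ, he, -⟩ _ ⟨x', n', y', rfl, σ', he', -⟩ ⟨z, hz⟩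
  have h : twoPart n (y ++ z) = twoPart n' y' := by rw [← hz]; simp [twoPart]
  obtain ⟨rfl, rfl⟩ := twoPart_inj h
  have := (he.extend z).det he'
  simp only [State.extend, State.mk.injEq, List.nil_append] at this
  simp [this.2]

/-! ### Complexity with respect to the machine -/

theorem machine_twoPart (n : ℕ) (y : List Bool) :
    machine (twoPart n y) = (sentence n).run y := by
  ext x
  rw [mem_machine, Sentence.mem_run]
  constructor
  · rintro ⟨n', y', e, h⟩
    obtain ⟨rfl, rfl⟩ := twoPart_inj e
    exact h
  · exact fun h => ⟨n, y, rfl, h⟩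

theorem length_twoPart (n : ℕ) (y : List Bool) :
    (twoPart n y).length = y.length + (2 * (bstr n).length + 1) := by
  simp only [twoPart, selfDelim, List.length_append, List.length_replicate, List.length_cons]
  omega

/-- Each program `p` of `G` becomes the program `twoPart n p` of the machine. Since addition of a
constant commutes with the infimum, programs can be compared one at a time, and an empty infimum
causes no trouble. -/
theorem complexity_machine_le {G : List Bool →. List Bool} {n : ℕ}
    (h : ∀ y, (sentence n).run y = G y) (x : List Bool) :
    complexity machine x ≤ complexity G x + (2 * (bstr n).length + 1 : ℕ) := by
  rw [complexity, complexity]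
  simp only [ENat.iInf_add]
  refine le_iInf₂ fun p hp => ?_
  rw [← h, ← machine_twoPart] at hp
  refine (iInf₂_le (f := fun p (_ : x ∈ machine p) => (p.length : ℕ∞)) _ hp).trans ?_
  rw [length_twoPart, Nat.cast_add]

/-! ### Execution as a partial function -/

/-- Started in the state `s`, the sentence `P` halts exactly in the states in `r`. -/
def Runs (P : Sentence) (s : State) (r : Part State) : Prop :=
  ∀ t, Exec P s t ↔ t ∈ r

theorem Exec.runs {P : Sentence} {s t : State} (h : Exec P s t) : Runs P s (Part.some t) :=
  fun _ => ⟨fun h' => Part.mem_some_iff.2 (h'.det h), fun h' => Part.mem_some_iff.1 h' ▸ h⟩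

theorem exec_seq {P Q : Sentence} {s t : State} :
    Exec (.seq P Q) s t ↔ ∃ u, Exec P s u ∧ Exec Q u t :=
  ⟨fun h => by cases h with | seq h₁ h₂ => exact ⟨_, h₁, h₂⟩, fun ⟨_, h₁, h₂⟩ => .seq h₁ h₂⟩

theorem exec_while_true {b : BExp} {P : Sentence} {s s₁ t : State}
    (hb : b.eval s = some (true, s₁)) :
    Exec (.whileDo b P) s t ↔ ∃ u, Exec P s₁ u ∧ Exec (.whileDo b P) u t := by
  refine ⟨fun h => ?_, fun ⟨_, h₁, h₂⟩ => .while_true hb h₁ h₂⟩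
  cases h with
  | while_true hb' h₁ h₂ =>
    rw [hb] at hb'
    cases hb'
    exact ⟨_, h₁, h₂⟩
  | while_false hb' => simp_all

theorem Runs.seq_some {P Q : Sentence} {s u : State} {r : Part State}
    (hP : Exec P s u) (hQ : Runs Q u r) : Runs (.seq P Q) s r := by
  intro t
  rw [exec_seq, ← hQ t]
  exact ⟨fun ⟨u', h₁, h₂⟩ => hP.det h₁ ▸ h₂, fun h => ⟨u, hP, h⟩⟩

/-- The intermediate state is known up to one number `v`, the result of a partial computation.
Chains of this lemma verify a straight-line program command by command. -/
theorem Runs.seq_map {P Q : Sentence} {s : State} {p : Part ℕ} {g : ℕ → State}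
    {q : ℕ → Part State} (hP : Runs P s (p.map g)) (hQ : ∀ v ∈ p, Runs Q (g v) (q v)) :
    Runs (.seq P Q) s (p.bind q) := by
  intro t
  simp only [exec_seq, Part.mem_bind_iff, hP _, Part.mem_map_iff]
  constructor
  · rintro ⟨_, ⟨v, hv, rfl⟩, h⟩
    exact ⟨v, hv, (hQ v hv t).1 h⟩
  · rintro ⟨v, hv, h⟩
    exact ⟨_, ⟨v, hv, rfl⟩, (hQ v hv t).2 h⟩

/-! ### Memory frames -/

/-- The memory `m` with the locations from `b` on holding the list `l`, followed by zeros. -/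
def put (m : ℕ → ℕ) (b : ℕ) (l : List ℕ) : ℕ → ℕ :=
  fun j => if j < b then m j else l.getD (j - b) 0

/-- The state with memory `put m b l` and unread input `y`. -/
def frame (m : ℕ → ℕ) (b : ℕ) (l : List ℕ) (y : List Bool) : State := ⟨put m b l, y⟩

theorem frame_mem (m : ℕ → ℕ) (b : ℕ) (l : List ℕ) (y : List Bool) :
    (frame m b l y).mem = put m b l := rfl

theorem put_self (m : ℕ → ℕ) (b : ℕ) (l : List ℕ) : put m b l b = l.getD 0 0 := by
  simp [put]

theorem put_add (m : ℕ → ℕ) (b i : ℕ) (l : List ℕ) : put m b l (b + i) = l.getD i 0 := by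
  simp [put]

/-- A frame is zero beyond its list, so scratch locations can be added or dropped freely as long as
they hold `0`. -/
theorem put_append_zeros (m : ℕ → ℕ) (b : ℕ) (l : List ℕ) (r : ℕ) :
    put m b (l ++ List.replicate r 0) = put m b l := by
  funext j
  simp only [put]
  split_ifs
  · rfl
  · simp only [List.getD_eq_getElem?_getD, List.getElem?_append, List.getElem?_replicate]
    split_ifs with h1 h2
    · rfl
    · simp [List.getElem?_eq_none (not_lt.1 h1)]
    · simp [List.getElem?_eq_none (not_lt.1 h1)]

/-- A frame based above another one merges with it. This lets a subprogram work at `b + l.length`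
while the list `l` below it is preserved. -/
theorem put_put (m : ℕ → ℕ) (b : ℕ) (l l' : List ℕ) :
    put (put m b l) (b + l.length) l' = put m b (l ++ l') := by
  funext j
  simp only [put, List.getD_eq_getElem?_getD, List.getElem?_append]
  split_ifs <;> first | rfl | omega | rw [Nat.sub_sub]

theorem update_put (m : ℕ → ℕ) (b i v : ℕ) (l : List ℕ) (hi : i < l.length) :
    Function.update (put m b l) (b + i) v = put m b (l.set i v) := by
  funext j
  simp only [Function.update_apply, put, List.getD_eq_getElem?_getD, List.getElem?_set]
  split_ifs <;> first | rfl | omega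

theorem exec_assign_frame {a : AExp} {m : ℕ → ℕ} {b i v : ℕ} {l : List ℕ} {y y' : List Bool}
    (ha : a.eval (frame m b l y) = some (v, frame m b l y')) (hi : i < l.length) :
    Exec (.assign (b + i) a) (frame m b l y) (frame m b (l.set i v) y') := by
  have := Exec.assign (n := b + i) ha
  rwa [frame_mem, update_put _ _ _ _ _ hi] at this

/-- The sentence `P` computes the partial function `f` on the memory location `b`, provided that
all later locations hold `0`; no other location is changed, and no bit is read. -/
def Realizes (P : Sentence) (b : ℕ) (f : ℕ → Part ℕ) : Prop :=
  ∀ m n y, Runs P (frame m b [n] y) ((f n).map fun v => frame m b [v] y)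

/-- The locations in `l` are part of the untouched memory below the base of `P`, and the trailing
zeros meet the requirement that its scratch space be clear. -/
theorem Realizes.runs_frame {P : Sentence} {b : ℕ} {f : ℕ → Part ℕ} (l : List ℕ) (r : ℕ)
    (h : Realizes P (b + l.length) f) (m : ℕ → ℕ) (n : ℕ) (y : List Bool) :
    Runs P (frame m b (l ++ n :: List.replicate r 0) y)
      ((f n).map fun v => frame m b (l ++ v :: List.replicate r 0) y) := by
  have key : ∀ v, frame (put m b l) (b + l.length) [v] y =
      frame m b (l ++ v :: List.replicate r 0) y := by
    intro v
    rw [frame, frame, put_put, ← put_append_zeros m b (l ++ [v]) r]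
    simp
  have := h (put m b l) n y
  simpa only [key] using this

theorem frame_append_zeros (m : ℕ → ℕ) (b : ℕ) (l : List ℕ) (r : ℕ) (y : List Bool) :
    frame m b (l ++ List.replicate r 0) y = frame m b l y := by
  rw [frame, put_append_zeros, frame]

/-! ### Programs for the partial recursive functions -/

/-- The program that stores the pair of the contents of the locations `i` and `j` in `d`. -/
def pairProg (d i j : ℕ) : Sentence :=
  .ite (.lt (.loc i) (.loc j)) (.assign d (.add (.mul (.loc j) (.loc j)) (.loc i)))
    (.assign d (.add (.add (.mul (.loc i) (.loc i)) (.loc i)) (.loc j)))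

/-- The program transcribes the case distinction in `Nat.pair`, the pairing on which `Nat.Partrec`
is built; it is not the Cantor pairing of the enumeration. The target `d` may coincide with `i` or
`j`, because the result is stored in a single assignment. -/
theorem exec_pairProg (m : ℕ → ℕ) (b d i j : ℕ) (l : List ℕ) (y : List Bool)
    (hd : d < l.length) :
    Exec (pairProg (b + d) (b + i) (b + j)) (frame m b l y)
      (frame m b (l.set d (Nat.pair (l.getD i 0) (l.getD j 0))) y) := by
  rw [Nat.pair]
  split_ifs with h
  · refine .ite_true (s₁ := frame m b l y) ?_ (exec_assign_frame ?_ hd)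
    · simpa [BExp.eval, AExp.eval, frame_mem, put_add] using h
    · simp [AExp.eval, frame_mem, put_add]
  · refine .ite_false (s₁ := frame m b l y) ?_ (exec_assign_frame ?_ hd)
    · simpa [BExp.eval, AExp.eval, frame_mem, put_add, put_self] using h
    · simp [AExp.eval, frame_mem, put_add]

theorem exec_copy (m : ℕ → ℕ) (b d i : ℕ) (l : List ℕ) (y : List Bool) (hd : d < l.length) :
    Exec (.assign (b + d) (.loc (b + i))) (frame m b l y)
      (frame m b (l.set d (l.getD i 0)) y) :=
  exec_assign_frame (by simp only [AExp.eval, frame_mem, put_add]) hd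

theorem exec_num (m : ℕ → ℕ) (b d k : ℕ) (l : List ℕ) (y : List Bool) (hd : d < l.length) :
    Exec (.assign (b + d) (.num k)) (frame m b l y) (frame m b (l.set d k) y) :=
  exec_assign_frame (by simp only [AExp.eval]) hd

theorem exec_incr (m : ℕ → ℕ) (b d : ℕ) (l : List ℕ) (y : List Bool) (hd : d < l.length) :
    Exec (.assign (b + d) (.add (.loc (b + d)) (.num 1))) (frame m b l y)
      (frame m b (l.set d (l.getD d 0 + 1)) y) :=
  exec_assign_frame (by simp [AExp.eval, frame_mem, put_add]) hd

/-- The program that replaces `0` in the location `b + 1` by the square root of the content of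
the location `b`. -/
def sqrtProg (b : ℕ) : Sentence :=
  .whileDo (.not (.lt (.loc (b + 0)) (.mul (.add (.loc (b + 1)) (.num 1))
      (.add (.loc (b + 1)) (.num 1)))))
    (.assign (b + 1) (.add (.loc (b + 1)) (.num 1)))

theorem exec_sqrtProg (m : ℕ → ℕ) (b n : ℕ) (y : List Bool) :
    Exec (sqrtProg b) (frame m b [n, 0] y) (frame m b [n, n.sqrt] y) := by
  -- Here `k` counts the remaining iterations.
  have key : ∀ k i, i + k = n.sqrt →
      Exec (sqrtProg b) (frame m b [n, i] y) (frame m b [n, n.sqrt] y) := by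
    intro k
    induction k with
    | zero =>
      rintro i rfl
      refine .while_false ?_
      simpa [BExp.eval, AExp.eval, frame_mem, put_add, put_self] using
        Nat.sqrt_lt.1 (Nat.lt_succ_self n.sqrt)
    | succ k ih =>
      intro i hi
      refine .while_true (s₁ := frame m b [n, i] y) ?_ (exec_incr m b 1 [n, i] y (by simp))
        (by exact ih (i + 1) (by omega))
      have : ¬ n.sqrt < i + 1 := by omega
      rw [Nat.sqrt_lt] at this
      simpa [BExp.eval, AExp.eval, frame_mem, put_add, put_self] using this
  exact key n.sqrt 0 (by omega)

/-- The program that replaces the content of the location `b` by the first component of the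
pair that it encodes. -/
def leftProg (b : ℕ) : Sentence :=
  .seq (sqrtProg b) <| .seq
    (.ite (.lt (.sub (.loc (b + 0)) (.mul (.loc (b + 1)) (.loc (b + 1)))) (.loc (b + 1)))
      (.assign (b + 0) (.sub (.loc (b + 0)) (.mul (.loc (b + 1)) (.loc (b + 1)))))
      (.assign (b + 0) (.loc (b + 1))))
    (.assign (b + 1) (.num 0))

/-- The program that replaces the content of the location `b` by the second component of the
pair that it encodes. -/
def rightProg (b : ℕ) : Sentence :=
  .seq (sqrtProg b) <| .seq
    (.ite (.lt (.sub (.loc (b + 0)) (.mul (.loc (b + 1)) (.loc (b + 1)))) (.loc (b + 1)))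
      (.assign (b + 0) (.loc (b + 1)))
      (.assign (b + 0) (.sub (.sub (.loc (b + 0)) (.mul (.loc (b + 1)) (.loc (b + 1))))
        (.loc (b + 1)))))
    (.assign (b + 1) (.num 0))

theorem exec_leftProg (m : ℕ → ℕ) (b n : ℕ) (y : List Bool) :
    Exec (leftProg b) (frame m b [n] y) (frame m b [n.unpair.1] y) := by
  -- The location `b + 1` is scratch space for the square root and is cleared at the end.
  rw [← frame_append_zeros m b [n] 1, ← frame_append_zeros m b [n.unpair.1] 1]
  refine .seq (exec_sqrtProg m b n y) (.seq (s₁ := frame m b [n.unpair.1, n.sqrt] y) ?_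
    (exec_num m b 1 0 [n.unpair.1, n.sqrt] y (by simp)))
  rw [Nat.unpair]
  split_ifs with h
  · refine .ite_true (s₁ := frame m b [n, n.sqrt] y) ?_
      (exec_assign_frame (l := [n, n.sqrt]) ?_ (by simp))
    · simpa [BExp.eval, AExp.eval, frame_mem, put_add, put_self] using h
    · simp [AExp.eval, frame_mem, put_add, put_self]
  · refine .ite_false (s₁ := frame m b [n, n.sqrt] y) ?_
      (exec_assign_frame (l := [n, n.sqrt]) ?_ (by simp))
    · simpa [BExp.eval, AExp.eval, frame_mem, put_add, put_self] using h
    · simp [AExp.eval, frame_mem, put_add]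

theorem exec_rightProg (m : ℕ → ℕ) (b n : ℕ) (y : List Bool) :
    Exec (rightProg b) (frame m b [n] y) (frame m b [n.unpair.2] y) := by
  rw [← frame_append_zeros m b [n] 1, ← frame_append_zeros m b [n.unpair.2] 1]
  refine .seq (exec_sqrtProg m b n y) (.seq (s₁ := frame m b [n.unpair.2, n.sqrt] y) ?_
    (exec_num m b 1 0 [n.unpair.2, n.sqrt] y (by simp)))
  rw [Nat.unpair]
  split_ifs with h
  · refine .ite_true (s₁ := frame m b [n, n.sqrt] y) ?_
      (exec_assign_frame (l := [n, n.sqrt]) ?_ (by simp))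
    · simpa [BExp.eval, AExp.eval, frame_mem, put_add, put_self] using h
    · simp [AExp.eval, frame_mem, put_add]
  · refine .ite_false (s₁ := frame m b [n, n.sqrt] y) ?_
      (exec_assign_frame (l := [n, n.sqrt]) ?_ (by simp))
    · simpa [BExp.eval, AExp.eval, frame_mem, put_add, put_self] using h
    · simp [AExp.eval, frame_mem, put_add, put_self]

theorem Runs.congr {P : Sentence} {s : State} {r r' : Part State} (h : Runs P s r)
    (e : r = r') : Runs P s r' := e ▸ h

theorem Runs.while_true {b : BExp} {P : Sentence} {s s₁ : State} {p : Part ℕ} {g : ℕ → State}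
    {q : ℕ → Part State} (hb : b.eval s = some (true, s₁)) (hP : Runs P s₁ (p.map g))
    (hw : ∀ v ∈ p, Runs (.whileDo b P) (g v) (q v)) : Runs (.whileDo b P) s (p.bind q) := by
  intro t
  rw [exec_while_true hb, ← exec_seq]
  exact hP.seq_map hw t

theorem Realizes.exec_frame {P : Sentence} {b : ℕ} {f : ℕ → ℕ} (l : List ℕ) (r : ℕ)
    (h : Realizes P (b + l.length) fun n => Part.some (f n)) (m : ℕ → ℕ) (n : ℕ) (y : List Bool) :
    Exec P (frame m b (l ++ n :: List.replicate r 0) y)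
      (frame m b (l ++ f n :: List.replicate r 0) y) :=
  (h.runs_frame l r m n y _).2 (by simp)

theorem realizes_of_exec {P : Sentence} {b : ℕ} {f : ℕ → ℕ}
    (h : ∀ m n y, Exec P (frame m b [n] y) (frame m b [f n] y)) :
    Realizes P b fun n => Part.some (f n) :=
  fun m n y => (h m n y).runs.congr (by simp)

theorem realizes_left (b : ℕ) : Realizes (leftProg b) b fun n => Part.some n.unpair.1 :=
  realizes_of_exec fun m n y => exec_leftProg m b n y

theorem realizes_right (b : ℕ) : Realizes (rightProg b) b fun n => Part.some n.unpair.2 :=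
  realizes_of_exec fun m n y => exec_rightProg m b n y

theorem Realizes.comp {P Q : Sentence} {b : ℕ} {f g : ℕ → Part ℕ} (hf : Realizes P b f)
    (hg : Realizes Q b g) : Realizes (.seq Q P) b fun n => g n >>= f := by
  intro m n y
  refine ((hg m n y).seq_map fun v _ => hf m v y).congr ?_
  simp only [Part.bind_eq_bind, Part.map_bind]

/-- The argument stays in `b`, and copies of it are processed in `b + 1` and `b + 2`. The base of
`Q` is higher, so that the first result survives in `b + 1`. -/
theorem Realizes.pair {P Q : Sentence} {b : ℕ} {f g : ℕ → Part ℕ} (hf : Realizes P (b + 1) f)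
    (hg : Realizes Q (b + 2) g) :
    ∃ R, Realizes R b fun n => Nat.pair <$> f n <*> g n := by
  refine ⟨.seq (.assign (b + 1) (.loc (b + 0))) <| .seq P <|
    .seq (.assign (b + 2) (.loc (b + 0))) <| .seq Q <| .seq (pairProg (b + 0) (b + 1) (b + 2)) <|
    .seq (.assign (b + 1) (.num 0)) (.assign (b + 2) (.num 0)), fun m n y => ?_⟩
  rw [← frame_append_zeros m b [n] 2]
  refine (Runs.seq_some (exec_copy m b 1 0 [n, 0, 0] y (by simp)) <|
    (hf.runs_frame [n] 1 m n y).seq_map fun v _ =>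
    Runs.seq_some (exec_copy m b 2 0 [n, v, 0] y (by simp)) <|
    (hg.runs_frame [n, v] 0 m n y).seq_map fun w _ =>
    Runs.seq_some (exec_pairProg m b 0 1 2 [n, v, w] y (by simp)) <|
    Runs.seq_some (exec_num m b 1 0 [Nat.pair v w, v, w] y (by simp)) <|
    (exec_num m b 2 0 [Nat.pair v w, 0, w] y (by simp)).runs).congr ?_
  have e : ∀ v, frame m b [v, 0, 0] y = frame m b [v] y := fun v =>
    frame_append_zeros m b [v] 2 y
  ext t
  simp [Seq.seq, e, Part.mem_bind_iff]
  grind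

/-- The result of `k` steps `a ↦ h j a`, `j = i, i + 1, …`. -/
def iterFrom (h : ℕ → ℕ → Part ℕ) : ℕ → ℕ → ℕ → Part ℕ
  | 0, _, a => Part.some a
  | k + 1, i, a => (h i a).bind (iterFrom h k (i + 1))

/-- `Nat.rec` splits off the last step, whereas a loop splits off the first one. Associativity of
`bind` translates between the two. -/
theorem rec_eq_iterFrom (x : Part ℕ) (h : ℕ → ℕ → Part ℕ) (k i : ℕ) :
    (Nat.rec x (fun j r => r.bind (h j)) (i + k) : Part ℕ) =
      (Nat.rec x (fun j r => r.bind (h j)) i : Part ℕ).bind (iterFrom h k i) := by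
  induction k generalizing i with
  | zero => exact (Part.bind_some_right _).symm
  | succ k ih =>
    rw [show i + (k + 1) = i + 1 + k by omega, ih (i + 1)]
    exact Part.bind_assoc _ _ _

/-- The locations `b, …, b + 4` hold the packed argument, `a`, the bound `n`, the counter and the
accumulator. `P` and `Q` work on the accumulator, which comes last so that all locations above it
are free. -/
theorem Realizes.prec {P Q : Sentence} {b : ℕ} {f g : ℕ → Part ℕ} (hf : Realizes P (b + 4) f)
    (hg : Realizes Q (b + 4) g) :
    ∃ R, Realizes R b (Nat.unpaired fun a n =>
      n.rec (f a) fun j r => do let i ← r; g (Nat.pair a (Nat.pair j i))) := by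
  obtain ⟨body, hbody⟩ : ∃ body, ∀ m p a n i c y, Runs body (frame m b [p, a, n, i, c] y)
      ((g (Nat.pair a (Nat.pair i c))).map fun v => frame m b [p, a, n, i + 1, v] y) := by
    -- The two pairings build the argument `⟨a, ⟨i, c⟩⟩` of `g` in the accumulator.
    refine ⟨.seq (pairProg (b + 4) (b + 3) (b + 4)) <| .seq (pairProg (b + 4) (b + 1) (b + 4)) <|
      .seq Q (.assign (b + 3) (.add (.loc (b + 3)) (.num 1))), fun m p a n i c y => ?_⟩
    refine (Runs.seq_some (exec_pairProg m b 4 3 4 [p, a, n, i, c] y (by simp)) <|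
      Runs.seq_some (exec_pairProg m b 4 1 4 [p, a, n, i, Nat.pair i c] y (by simp)) <|
      (hg.runs_frame [p, a, n, i] 0 m _ y).seq_map fun v _ =>
      (exec_incr m b 3 [p, a, n, i, v] y (by simp)).runs).congr ?_
    exact Part.bind_some_eq_map _ _
  let loop : Sentence := .whileDo (.lt (.loc (b + 3)) (.loc (b + 2))) body
  -- With the bound written as `i + k`, the induction is on the number `k` of remaining iterations.
  have hloop : ∀ m p a y k i c, Runs loop (frame m b [p, a, i + k, i, c] y)
      ((iterFrom (fun j r => g (Nat.pair a (Nat.pair j r))) k i c).map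
        fun v => frame m b [p, a, i + k, i + k, v] y) := by
    intro m p a y k
    induction k with
    | zero =>
      intro i c
      refine (Exec.while_false (s₁ := frame m b [p, a, i, i, c] y) ?_).runs.congr ?_
      · simp [BExp.eval, AExp.eval, frame_mem, put_add]
      · simp [iterFrom]
    | succ k ih =>
      intro i c
      rw [iterFrom, Part.map_bind]
      refine Runs.while_true (s₁ := frame m b [p, a, i + (k + 1), i, c] y) ?_
        (hbody m p a (i + (k + 1)) i c y) fun v _ => ?_
      · simp [BExp.eval, AExp.eval, frame_mem, put_add]
      · have := ih (i + 1) v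
        rwa [show i + 1 + k = i + (k + 1) by omega] at this
  refine ⟨.seq (.assign (b + 1) (.loc (b + 0))) <| .seq (leftProg (b + 1)) <|
    .seq (.assign (b + 2) (.loc (b + 0))) <| .seq (rightProg (b + 2)) <|
    .seq (.assign (b + 4) (.loc (b + 1))) <| .seq P <| .seq loop <|
    .seq (.assign (b + 0) (.loc (b + 4))) <| .seq (.assign (b + 1) (.num 0)) <|
    .seq (.assign (b + 2) (.num 0)) <| .seq (.assign (b + 3) (.num 0)) <|
    (.assign (b + 4) (.num 0)), fun m p y => ?_⟩
  rw [← frame_append_zeros m b [p] 4]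
  have hloop' := fun c => hloop m p p.unpair.1 y p.unpair.2 0 c
  simp only [Nat.zero_add] at hloop'
  refine (Runs.seq_some (exec_copy m b 1 0 [p, 0, 0, 0, 0] y (by simp)) <|
    Runs.seq_some ((realizes_left (b + 1)).exec_frame [p] 3 m p y) <|
    Runs.seq_some (exec_copy m b 2 0 [p, p.unpair.1, 0, 0, 0] y (by simp)) <|
    Runs.seq_some ((realizes_right (b + 2)).exec_frame [p, p.unpair.1] 2 m p y) <|
    Runs.seq_some (exec_copy m b 4 1 [p, p.unpair.1, p.unpair.2, 0, 0] y (by simp)) <|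
    (hf.runs_frame [p, p.unpair.1, p.unpair.2, 0] 0 m p.unpair.1 y).seq_map fun c _ =>
    (hloop' c).seq_map fun v _ =>
    Runs.seq_some (exec_copy m b 0 4 [p, p.unpair.1, p.unpair.2, p.unpair.2, v] y (by simp)) <|
    Runs.seq_some (exec_num m b 1 0 [v, p.unpair.1, p.unpair.2, p.unpair.2, v] y (by simp)) <|
    Runs.seq_some (exec_num m b 2 0 [v, 0, p.unpair.2, p.unpair.2, v] y (by simp)) <|
    Runs.seq_some (exec_num m b 3 0 [v, 0, 0, p.unpair.2, v] y (by simp)) <|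
    (exec_num m b 4 0 [v, 0, 0, 0, v] y (by simp)).runs).congr ?_
  have e : ∀ v, frame m b [v, 0, 0, 0, 0] y = frame m b [v] y := fun v =>
    frame_append_zeros m b [v] 4 y
  have h := rec_eq_iterFrom (f p.unpair.1)
    (fun j r => g (Nat.pair p.unpair.1 (Nat.pair j r))) p.unpair.2 0
  rw [Nat.zero_add] at h
  simp only [Nat.unpaired, Part.bind_eq_bind, h, Part.map_bind, List.set, e]
  simp only [Part.bind_some_eq_map]
  rfl

/-- The locations `b`, `b + 1`, `b + 2` hold `n`, the candidate `i` and the value of `f` at `⟨n,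
i⟩`. If a value is undefined or no zero exists, no execution derivation exists, and this matches the
domain of `Nat.rfind`. -/
theorem Realizes.rfind {P : Sentence} {b : ℕ} {f : ℕ → Part ℕ} (hf : Realizes P (b + 2) f) :
    ∃ R, Realizes R b fun n => Nat.rfind fun i => (fun r => r = 0) <$> f (Nat.pair n i) := by
  let test : Sentence := .seq (pairProg (b + 2) (b + 0) (b + 1)) P
  have htest : ∀ m n i r y, Runs test (frame m b [n, i, r] y)
      ((f (Nat.pair n i)).map fun v => frame m b [n, i, v] y) := fun m n i r y =>
    Runs.seq_some (exec_pairProg m b 2 0 1 [n, i, r] y (by simp)) <|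
      hf.runs_frame [n, i] 0 m (Nat.pair n i) y
  let body : Sentence := .seq (.assign (b + 1) (.add (.loc (b + 1)) (.num 1))) test
  have hbody : ∀ m n i r y, Runs body (frame m b [n, i, r] y)
      ((f (Nat.pair n (i + 1))).map fun v => frame m b [n, i + 1, v] y) := fun m n i r y =>
    Runs.seq_some (exec_incr m b 1 [n, i, r] y (by simp)) (htest m n (i + 1) r y)
  let cond : BExp := .lt (.num 0) (.loc (b + 2))
  have hcond : ∀ m n i r y, cond.eval (frame m b [n, i, r] y) =
      some (decide (0 < r), frame m b [n, i, r] y) := fun m n i r y => by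
    simp [cond, BExp.eval, AExp.eval, frame_mem, put_add]
  -- The loop invariant is that `r` is the value at the current candidate `i`.
  have hloop : ∀ m n y i r, r ∈ f (Nat.pair n i) → ∀ t,
      Exec (.whileDo cond body) (frame m b [n, i, r] y) t ↔
        ∃ j, i ≤ j ∧ 0 ∈ f (Nat.pair n j) ∧
          (∀ k, i ≤ k → k < j → ∃ v ∈ f (Nat.pair n k), v ≠ 0) ∧ t = frame m b [n, j, 0] y := by
    intro m n y i r hr t
    constructor
    · intro h
      -- The number of iterations is not known in advance, so the induction is on the derivation of
      -- the execution.
      generalize hW : Sentence.whileDo cond body = W at h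
      generalize hs : frame m b [n, i, r] y = s at h
      induction h generalizing i r with
      | while_true hb hP _ _ ih =>
        cases hW
        subst hs
        rw [hcond] at hb
        simp only [Option.some.injEq, Prod.mk.injEq, decide_eq_true_eq] at hb
        obtain ⟨hpos, rfl⟩ := hb
        rw [hbody m n i r y, Part.mem_map_iff] at hP
        obtain ⟨v, hv, e⟩ := hP
        obtain ⟨j, hij, h0, hlt, ht⟩ := ih (i + 1) v hv rfl e
        refine ⟨j, by omega, h0, fun k hk hkj => ?_, ht⟩
        rcases hk.eq_or_lt with rfl | hk
        · exact ⟨r, hr, by omega⟩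
        · exact hlt k hk hkj
      | while_false hb =>
        cases hW
        subst hs
        rw [hcond] at hb
        simp only [Option.some.injEq, Prod.mk.injEq, decide_eq_false_iff_not, not_lt,
          Nat.le_zero] at hb
        obtain ⟨rfl, rfl⟩ := hb
        exact ⟨i, le_rfl, hr, fun k hk hki => absurd hki (not_lt.2 hk), rfl⟩
      | _ => cases hW
    · rintro ⟨j, hij, h0, hlt, rfl⟩
      obtain ⟨k, rfl⟩ := Nat.exists_eq_add_of_le hij
      induction k generalizing i r with
      | zero =>
        obtain rfl := Part.mem_unique hr h0
        exact .while_false (by simpa using hcond m n i 0 y)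
      | succ k ih =>
        have hpos : 0 < r := by
          obtain ⟨v, hv, h⟩ := hlt i le_rfl (by omega)
          obtain rfl := Part.mem_unique hr hv
          omega
        -- The next value is defined: either it is the zero at `j`, or it is one of the nonzero
        -- values before `j`.
        obtain ⟨v, hv⟩ : ∃ v, v ∈ f (Nat.pair n (i + 1)) := by
          rcases Nat.eq_zero_or_pos k with rfl | hk
          · exact ⟨0, h0⟩
          · exact (hlt (i + 1) (by omega) (by omega)).imp fun _ h => h.1
        refine .while_true (s₁ := frame m b [n, i, r] y) (by simpa [hpos] using hcond m n i r y)
          ((hbody m n i r y _).2 (Part.mem_map _ hv)) ?_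
        have := ih (i + 1) v hv (by omega)
        rw [show i + 1 + k = i + (k + 1) by omega] at this
        exact this h0 fun k' hk hk' => hlt k' (by omega) hk'
  -- The search starts at `0`, the initial content of `b + 1`. On exit `b + 2` holds the zero that
  -- was found, so only `b + 1` has to be cleared.
  refine ⟨.seq test <| .seq (.whileDo cond body) <| .seq (.assign (b + 0) (.loc (b + 1)))
    (.assign (b + 1) (.num 0)), fun m n y t => ?_⟩
  have e : ∀ v, frame m b [v, 0, 0] y = frame m b [v] y := fun v =>
    frame_append_zeros m b [v] 2 y
  have hend : ∀ j, Exec (.seq (.assign (b + 0) (.loc (b + 1))) (.assign (b + 1) (.num 0)))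
      (frame m b [n, j, 0] y) (frame m b [j] y) := fun j => by
    rw [← e]
    exact .seq (exec_copy m b 0 1 [n, j, 0] y (by simp)) (exec_num m b 1 0 [j, j, 0] y (by simp))
  have hmem : ∀ j, j ∈ Nat.rfind (fun i => (fun r => decide (r = 0)) <$> f (Nat.pair n i)) ↔
      0 ∈ f (Nat.pair n j) ∧ ∀ k, 0 ≤ k → k < j → ∃ v ∈ f (Nat.pair n k), v ≠ 0 := by
    intro j
    refine Nat.mem_rfind.trans (and_congr ?_ ⟨fun h k _ hk => ?_, fun h k hk => ?_⟩)
    · simp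
    · simpa using h hk
    · simpa using h k (Nat.zero_le k) hk
  rw [← e n, exec_seq, Part.mem_map_iff]
  simp only [hmem, exec_seq (P := .whileDo _ _)]
  constructor
  · rintro ⟨u, h₁, u', h₂, h₃⟩
    obtain ⟨r, hr, rfl⟩ := (Part.mem_map_iff _).1 ((htest m n 0 0 y u).1 h₁)
    obtain ⟨j, -, h0, hlt, rfl⟩ := (hloop m n y 0 r hr u').1 h₂
    exact ⟨j, ⟨h0, hlt⟩, (hend j).det h₃⟩
  · rintro ⟨j, ⟨h0, hlt⟩, rfl⟩
    obtain ⟨r, hr⟩ : ∃ r, r ∈ f (Nat.pair n 0) := by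
      rcases Nat.eq_zero_or_pos j with rfl | hj
      · exact ⟨0, h0⟩
      · exact (hlt 0 le_rfl hj).imp fun _ h => h.1
    exact ⟨_, (htest m n 0 0 y _).2 (Part.mem_map _ hr), _,
      (hloop m n y 0 r hr _).2 ⟨j, Nat.zero_le j, h0, hlt, rfl⟩, hend j⟩

/-- Every partial recursive function is computed by a program. -/
theorem exists_realizes {f : ℕ →. ℕ} (hf : Nat.Partrec f) (b : ℕ) : ∃ P, Realizes P b f := by
  induction hf generalizing b with
  | zero => exact ⟨.assign (b + 0) (.num 0),
      realizes_of_exec (f := fun _ => 0) fun m n y => exec_num m b 0 0 [n] y (by simp)⟩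
  | succ => exact ⟨.assign (b + 0) (.add (.loc (b + 0)) (.num 1)),
      realizes_of_exec fun m n y => exec_incr m b 0 [n] y (by simp)⟩
  | left => exact ⟨_, realizes_left b⟩
  | right => exact ⟨_, realizes_right b⟩
  | pair _ _ ihf ihg =>
    obtain ⟨P, hP⟩ := ihf (b + 1)
    obtain ⟨Q, hQ⟩ := ihg (b + 2)
    exact hP.pair hQ
  | comp _ _ ihf ihg =>
    obtain ⟨P, hP⟩ := ihf b
    obtain ⟨Q, hQ⟩ := ihg b
    exact ⟨_, hP.comp hQ⟩
  | prec _ _ ihf ihg =>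
    obtain ⟨P, hP⟩ := ihf (b + 4)
    obtain ⟨Q, hQ⟩ := ihg (b + 4)
    exact hP.prec hQ
  | rfind _ ih =>
    obtain ⟨P, hP⟩ := ih (b + 2)
    exact hP.rfind

/-! ### Search -/

/-- A partial function with a computable enumeration of its graph is partial recursive. -/
theorem exists_partrec_of_enum {α β σ : Type*} [Primcodable α] [Primcodable β] [Primcodable σ]
    {T : α → β → Option σ} (hT : Computable₂ T)
    (hu : ∀ a b b' x x', T a b = some x → T a b' = some x' → x = x') :
    ∃ F : α →. σ, Partrec F ∧ ∀ a x, x ∈ F a ↔ ∃ b, T a b = some x := by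
  refine ⟨fun a => Nat.rfindOpt fun k => (Encodable.decode k).bind (T a),
    Partrec.rfindOpt ?_, fun a x => ?_⟩
  · exact Computable.bind_decode_iff.2 hT
  · have hmem : ∀ x, x ∈ Nat.rfindOpt (fun k => (Encodable.decode k : Option β).bind (T a)) →
        ∃ b, T a b = some x := fun x h => by
      obtain ⟨k, hk⟩ := Nat.rfindOpt_spec h
      obtain ⟨b, -, hb⟩ := Option.bind_eq_some_iff.1 hk
      exact ⟨b, hb⟩
    refine ⟨hmem x, fun ⟨b, hb⟩ => ?_⟩
    have hd : (Nat.rfindOpt fun k => (Encodable.decode k : Option β).bind (T a)).Dom :=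
      Nat.rfindOpt_dom.2 ⟨Encodable.encode b, x, by simpa using hb⟩
    obtain ⟨b', hb'⟩ := hmem _ (Part.get_mem hd)
    -- The search may stop at a witness `b'` other than `b`; the uniqueness hypothesis makes the
    -- values agree.
    rw [hu a b b' _ _ hb hb']
    exact Part.get_mem hd

/-- The graph of a partial recursive function has a primitive recursive enumeration. -/
theorem exists_primrec_enum {α σ : Type*} [Primcodable α] [Primcodable σ] {G : α →. σ}
    (hG : Partrec G) :
    ∃ T : α → ℕ → Option σ, Primrec₂ T ∧ ∀ a x, x ∈ G a ↔ ∃ k, T a k = some x := by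
  obtain ⟨c, hc⟩ := Nat.Partrec.Code.exists_code.1 hG
  refine ⟨fun a k => (Nat.Partrec.Code.evaln k c (Encodable.encode a)).bind Encodable.decode,
    ?_, fun a x => ?_⟩
  · exact Primrec.option_bind
      (Nat.Partrec.Code.primrec_evaln.comp
        ((Primrec.snd.pair (Primrec.const c)).pair (Primrec.encode.comp Primrec.fst)))
      (Primrec.decode.comp Primrec.snd).to₂
  · have h : ∀ r, r ∈ c.eval (Encodable.encode a) ↔ ∃ x ∈ G a, Encodable.encode x = r := by
      simp [hc]
    constructor
    · intro hx
      obtain ⟨k, hk⟩ := Nat.Partrec.Code.evaln_complete.1 ((h _).2 ⟨x, hx, rfl⟩)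
      exact ⟨k, by simp [Option.mem_def.1 hk]⟩
    · rintro ⟨k, hk⟩
      obtain ⟨r, hr, hx⟩ := Option.bind_eq_some_iff.1 hk
      obtain ⟨x', hx', rfl⟩ := (h r).1 (Nat.Partrec.Code.evaln_complete.2 ⟨k, hr⟩)
      rw [Encodable.encodek, Option.some.injEq] at hx
      exact hx ▸ hx'

/-! ### The positions of the binary strings -/

/-- The position of a binary string in the enumeration `bstr`. -/
def bcode (l : List Bool) : ℕ := l.foldl (fun k d => 2 * k + 1 + d.toNat) 0

theorem bcode_append_singleton (l : List Bool) (d : Bool) :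
    bcode (l ++ [d]) = 2 * bcode l + 1 + d.toNat := by
  simp [bcode]

theorem bstr_bcode (l : List Bool) : bstr (bcode l) = l := by
  induction l using List.reverseRecOn with
  | nil => exact bstr_zero
  | append_singleton l d ih =>
    rw [bcode_append_singleton, show 2 * bcode l + 1 + d.toNat = 2 * bcode l + d.toNat + 1 by omega,
      bstr]
    cases d
    · simp [ih]
    · rw [Bool.toNat_true, show (2 * bcode l + 1) / 2 = bcode l by omega, ih]
      simp

theorem bcode_injective : Function.Injective bcode :=
  Function.LeftInverse.injective bstr_bcode

theorem primrec_bcode : Primrec bcode := by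
  exact Primrec.list_foldl (h := fun (_ : List Bool) (p : ℕ × Bool) => 2 * p.1 + 1 + p.2.toNat)
    Primrec.id (Primrec.const 0) (Primrec.nat_add.comp
      (Primrec.nat_double_succ.comp (Primrec.fst.comp Primrec.snd))
      ((Primrec.dom_bool Bool.toNat).comp (Primrec.snd.comp Primrec.snd)))

/-! ### A program for a prefix machine -/

/-- For a prefix machine `G` the function that tells, for a string `s` in the domain or with an
extension in the domain, which of the two is the case, and also the value at `s` in the first
case, is partial recursive. -/
theorem exists_lookahead {G : List Bool →. List Bool} (hG : IsPrefixMachine G) :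
    ∃ H : ℕ →. ℕ, Nat.Partrec H ∧ ∀ s v, v ∈ H (bcode s) ↔
      (∃ x ∈ G s, v = bcode x + 1) ∨ (v = 0 ∧ ∃ q ∈ G.Dom, s <+: q ∧ s ≠ q) := by
  obtain ⟨T, hT, hmem⟩ := exists_primrec_enum hG.partrec
  -- An index `((q, k), j)` stands for a halting computation on `q`, found at stage `k`, seen from
  -- the prefix of `q` of length `j`. A proper prefix is told to read on (`0`), and `q` itself
  -- receives its value. The shift by `1` keeps the two answers apart.
  let F : ℕ → (List Bool × ℕ) × ℕ → Option ℕ := fun s i =>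
    (T i.1.1 i.1.2).bind fun x => if bcode (i.1.1.take i.2) = s then
      some (if i.1.1.length ≤ i.2 then bcode x + 1 else 0) else none
  have hFp : Primrec₂ F := by
    refine Primrec.option_bind
      (hT.comp (Primrec.fst.comp (Primrec.fst.comp Primrec.snd))
        (Primrec.snd.comp (Primrec.fst.comp Primrec.snd))) ?_
    have hi : Primrec fun p : (ℕ × (List Bool × ℕ) × ℕ) × List Bool => p.1.2 :=
      Primrec.snd.comp Primrec.fst
    have hq : Primrec fun p : (ℕ × (List Bool × ℕ) × ℕ) × List Bool => p.1.2.1.1 :=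
      Primrec.fst.comp (Primrec.fst.comp hi)
    refine Primrec.ite ?_ (Primrec.option_some.comp (Primrec.ite ?_ ?_ (Primrec.const 0)))
      (Primrec.const none)
    · exact Primrec.eq.comp (primrec_bcode.comp (Primrec.list_take.comp (Primrec.snd.comp hi) hq))
        (Primrec.fst.comp Primrec.fst)
    · exact Primrec.nat_le.comp (Primrec.list_length.comp hq) (Primrec.snd.comp hi)
    · exact Primrec.succ.comp (primrec_bcode.comp Primrec.snd)
  have hF : ∀ s v, (∃ i, F (bcode s) i = some v) ↔
      (∃ x ∈ G s, v = bcode x + 1) ∨ (v = 0 ∧ ∃ q ∈ G.Dom, s <+: q ∧ s ≠ q) := by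
    intro s v
    constructor
    · rintro ⟨⟨⟨q, k⟩, j⟩, h⟩
      obtain ⟨x, hx, h⟩ := Option.bind_eq_some_iff.1 h
      simp only [Option.ite_none_right_eq_some, Option.some.injEq] at h
      obtain ⟨hs, hv⟩ := h
      have hxq : x ∈ G q := (hmem q x).2 ⟨k, hx⟩
      have hs := bcode_injective hs
      split_ifs at hv with hj
      · rw [List.take_of_length_le hj] at hs
        exact Or.inl ⟨x, hs ▸ hxq, hv.symm⟩
      · refine Or.inr ⟨hv.symm, q, Part.dom_iff_mem.2 ⟨x, hxq⟩, hs ▸ List.take_prefix j q, ?_⟩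
        rintro rfl
        have := congrArg List.length hs
        rw [List.length_take] at this
        omega
    · rintro (⟨x, hx, rfl⟩ | ⟨rfl, q, hq, hs, hne⟩)
      · obtain ⟨k, hk⟩ := (hmem s x).1 hx
        exact ⟨((s, k), s.length), by simp [F, hk]⟩
      · obtain ⟨x, hx⟩ := Part.dom_iff_mem.1 hq
        obtain ⟨k, hk⟩ := (hmem q x).1 hx
        refine ⟨((q, k), s.length), ?_⟩
        have hlt : s.length < q.length :=
          lt_of_le_of_ne hs.length_le fun h => hne (hs.eq_of_length h)
        simp [F, hk, ← List.prefix_iff_eq_take.1 hs, hlt]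
  have hbcode : ∀ n, bcode (bstr n) = n := fun n => bstr_injective (bstr_bcode _)
  obtain ⟨H, hH, hHm⟩ := exists_partrec_of_enum hFp.to_comp (by
    intro n i i' v v' h h'
    rw [← hbcode n] at h h'
    -- Prefix-freeness enters here: the two kinds of answer exclude each other.
    have hd : ∀ x ∈ G (bstr n), ¬ ∃ q ∈ G.Dom, bstr n <+: q ∧ bstr n ≠ q :=
      fun x hx ⟨q, hq, hp, hne⟩ =>
        hne (hG.prefixFree _ (Part.dom_iff_mem.2 ⟨x, hx⟩) q hq hp)
    rcases (hF _ v).1 ⟨i, h⟩ with ⟨x, hx, rfl⟩ | ⟨rfl, hq⟩ <;>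
      rcases (hF _ v').1 ⟨i', h'⟩ with ⟨x', hx', rfl⟩ | ⟨rfl, hq'⟩
    · rw [Part.mem_unique hx hx']
    · exact absurd hq' (hd x hx)
    · exact absurd hq (hd x' hx')
    · rfl)
  exact ⟨H, Partrec.nat_iff.1 hH, fun s v => (hHm _ v).trans (hF s v)⟩

/-- Every prefix machine is computed by a sentence. -/
theorem exists_sentence {G : List Bool →. List Bool} (hG : IsPrefixMachine G) :
    ∃ P : Sentence, ∀ y x, P.Outputs y x ↔ x ∈ G y := by
  obtain ⟨H, hHp, hH⟩ := exists_lookahead hG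
  -- Location `0` keeps the position of the string read so far; the look-ahead works from location
  -- `1` on.
  obtain ⟨PH, hPH⟩ := exists_realizes hHp 1
  let m : ℕ → ℕ := fun _ => 0
  let test : Sentence := .seq (.assign (0 + 1) (.loc (0 + 0))) PH
  have htest : ∀ n r z, Runs test (frame m 0 [n, r] z)
      ((H n).map fun v => frame m 0 [n, v] z) := fun n r z =>
    Runs.seq_some (exec_copy m 0 1 0 [n, r] z (by simp)) (hPH.runs_frame (b := 0) [n] 0 m n z)
  -- `k ↦ 2 k + 1 + d` sends the position of `s` to that of `s ++ [d]`.
  let next : AExp := .add (.add (.mul (.num 2) (.loc (0 + 0))) (.num 1)) .readbit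
  let body : Sentence := .seq (.assign (0 + 0) next) test
  have hbody : ∀ s r d z, Runs body (frame m 0 [bcode s, r] (d :: z))
      ((H (bcode (s ++ [d]))).map fun v => frame m 0 [bcode (s ++ [d]), v] z) :=
    fun s r d z => Runs.seq_some
      (exec_assign_frame (l := [bcode s, r]) (v := bcode (s ++ [d])) (by
        simp [next, AExp.eval, frame, put, bcode_append_singleton]) (by simp))
      (htest (bcode (s ++ [d])) r z)
  -- If another bit is demanded after the end of the input, the execution blocks, as it must when
  -- the input is a proper prefix of a program.
  have hbody_nil : ∀ n r t, ¬ Exec body (frame m 0 [n, r] []) t := fun n r t h => by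
    obtain ⟨u, h, -⟩ := exec_seq.1 h
    cases h with
    | assign h => simp [next, AExp.eval, frame] at h
  let cond : BExp := .eq (.loc (0 + 1)) (.num 0)
  have hcond : ∀ n r z, cond.eval (frame m 0 [n, r] z) =
      some (decide (r = 0), frame m 0 [n, r] z) := fun n r z => by
    simp [cond, BExp.eval, AExp.eval, frame_mem, put]
  -- The invariant is that `v` is the look-ahead at the string `s` read so far. The loop stops at
  -- the unique extension of `s` along the input that lies in the domain of `G`.
  have hloop : ∀ s v z t, v ∈ H (bcode s) →
      (Exec (.whileDo cond body) (frame m 0 [bcode s, v] z) t ↔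
        ∃ z₁ z₂ x, z = z₁ ++ z₂ ∧ x ∈ G (s ++ z₁) ∧
          t = frame m 0 [bcode (s ++ z₁), bcode x + 1] z₂) := by
    intro s v z t hv
    constructor
    · intro h
      generalize hW : Sentence.whileDo cond body = W at h
      generalize hs : frame m 0 [bcode s, v] z = u at h
      induction h generalizing s v z with
      | while_true hb hP _ _ ih =>
        cases hW
        subst hs
        rw [hcond] at hb
        simp only [Option.some.injEq, Prod.mk.injEq] at hb
        obtain ⟨-, rfl⟩ := hb
        cases z with
        | nil => exact absurd hP (hbody_nil _ _ _)
        | cons d z =>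
          obtain ⟨w, hw, e⟩ := (Part.mem_map_iff _).1 ((hbody s v d z _).1 hP)
          obtain ⟨z₁, z₂, x, rfl, hx, rfl⟩ := ih (s ++ [d]) w z hw rfl e
          exact ⟨d :: z₁, z₂, x, rfl, by simpa using hx, by simp⟩
      | while_false hb =>
        cases hW
        subst hs
        rw [hcond] at hb
        simp only [Option.some.injEq, Prod.mk.injEq, decide_eq_false_iff_not] at hb
        obtain ⟨hne, rfl⟩ := hb
        obtain ⟨x, hx, rfl⟩ : ∃ x ∈ G s, v = bcode x + 1 :=
          ((hH s v).1 hv).resolve_right fun h => hne h.1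
        exact ⟨[], z, x, rfl, by simpa using hx, by simp⟩
      | _ => cases hW
    · rintro ⟨z₁, z₂, x, rfl, hx, rfl⟩
      induction z₁ generalizing s v with
      | nil =>
        rw [List.append_nil] at hx ⊢
        obtain rfl := Part.mem_unique hv ((hH s _).2 (Or.inl ⟨x, hx, rfl⟩))
        exact .while_false (by simpa using hcond (bcode s) (bcode x + 1) z₂)
      | cons d z₁ ih =>
        have hdom : s ++ d :: z₁ ∈ G.Dom := Part.dom_iff_mem.2 ⟨x, hx⟩
        obtain rfl := Part.mem_unique hv ((hH s 0).2
          (Or.inr ⟨rfl, _, hdom, List.prefix_append s _, by simp⟩))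
        rw [show s ++ d :: z₁ = s ++ [d] ++ z₁ by simp] at hx hdom ⊢
        -- The look-ahead is defined along every prefix of a halting program.
        obtain ⟨w, hw⟩ : ∃ w, w ∈ H (bcode (s ++ [d])) := by
          cases z₁ with
          | nil => exact ⟨_, (hH _ _).2 (Or.inl ⟨x, by simpa using hx, rfl⟩)⟩
          | cons d' z₁ => exact ⟨0, (hH _ _).2
              (Or.inr ⟨rfl, _, hdom, List.prefix_append _ _, by simp⟩)⟩
        exact .while_true (s₁ := frame m 0 [bcode s, 0] (d :: (z₁ ++ z₂)))
          (by simpa using hcond (bcode s) 0 (d :: (z₁ ++ z₂)))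
          ((hbody s 0 d _ _).2 (Part.mem_map _ hw)) (ih (s ++ [d]) w hw hx)
  -- The subtraction undoes the shift in the look-ahead. With location `1` cleared, location `0`
  -- alone contributes to the output.
  let finish : Sentence := .seq (.assign (0 + 0) (.sub (.loc (0 + 1)) (.num 1)))
    (.assign (0 + 1) (.num 0))
  have hfinish : ∀ n c z, Exec finish (frame m 0 [n, c + 1] z) (frame m 0 [c] z) := by
    intro n c z
    rw [← frame_append_zeros m 0 [c] 1]
    exact .seq
      (exec_assign_frame (l := [n, c + 1]) (by
        simp only [AExp.eval, frame_mem]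
        simp [put]) (by simp))
      (exec_num m 0 1 0 [c, c + 1] z (by simp))
  have hout : ∀ x, MemOutput (put m 0 [bcode x]) x := fun x =>
    ⟨1, fun i hi => by
      obtain ⟨j, rfl⟩ := Nat.exists_eq_add_of_le' hi
      simp [put], by simp [put, bstr_bcode]⟩
  -- The zero memory is the frame for the empty string, since `bcode [] = 0`.
  have hinit : ∀ z, (⟨fun _ => 0, z⟩ : State) = frame m 0 [bcode [], 0] z := fun z => by
    rw [show [bcode [], 0] = [] ++ List.replicate 2 0 from rfl, frame_append_zeros]
    simp only [frame, State.mk.injEq, and_true]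
    funext j
    simp [put]
  refine ⟨.seq test (.seq (.whileDo cond body) finish), fun y x => ?_⟩
  simp only [Sentence.Outputs, hinit, exec_seq (P := test), exec_seq (P := .whileDo _ _)]
  constructor
  · rintro ⟨σ, ⟨u, h₁, u', h₂, h₃⟩, ho⟩
    obtain ⟨v, hv, rfl⟩ := (Part.mem_map_iff _).1 ((htest _ _ _ _).1 h₁)
    obtain ⟨z₁, z₂, x', rfl, hx', rfl⟩ := (hloop _ _ _ _ hv).1 h₂
    have e := (hfinish _ _ _).det h₃
    simp only [frame, State.mk.injEq] at e
    obtain ⟨rfl, rfl⟩ := e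
    rw [ho.unique (hout x')]
    simpa using hx'
  · intro hx
    obtain ⟨v, hv⟩ : ∃ v, v ∈ H (bcode []) := by
      cases y with
      | nil => exact ⟨_, (hH _ _).2 (Or.inl ⟨x, hx, rfl⟩)⟩
      | cons d y => exact ⟨0, (hH _ _).2 (Or.inr ⟨rfl, d :: y, Part.dom_iff_mem.2 ⟨x, hx⟩,
          List.nil_prefix, by simp⟩)⟩
    exact ⟨put m 0 [bcode x], ⟨_, (htest _ _ _ _).2 (Part.mem_map _ hv), _,
      (hloop _ _ _ _ hv).2 ⟨y, [], x, by simp, hx, rfl⟩, hfinish _ _ _⟩, hout x⟩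

/-! ### Computable evaluation of expressions with state -/

/-- Data for the evaluation of expressions of type `E` on states of type `S` to values of type
`V`. An expression without first argument is evaluated by `leaf`. Otherwise its first argument is
evaluated, the value of it decides on the second argument, which is evaluated next, and `comb`
combines the results. -/
structure Evaluator (E S V : Type) where
  leaf : E → S → Option (V × S)
  first : E → Option E
  second : E → V → E
  comb : E → V → V × S → V × S

namespace Evaluator

variable {E S V : Type} (ε : Evaluator E S V)

/-- Evaluation with recursion depth at most `k`. -/
def evaln : ℕ → E → S → Option (V × S)
  | 0, _, _ => none
  | k + 1, e, s =>
    match ε.first e with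
    | none => ε.leaf e s
    | some e₁ => (evaln k e₁ s).bind fun r₁ =>
      (evaln k (ε.second e r₁.1) r₁.2).map (ε.comb e r₁.1)

/-- Evaluation as a relation. -/
inductive Eval : E → S → V × S → Prop
  | leaf {e : E} {s : S} {r : V × S} (h : ε.first e = none) (hr : ε.leaf e s = some r) :
      Eval e s r
  | node {e e₁ : E} {s : S} {r₁ r₂ : V × S} (h : ε.first e = some e₁) (h₁ : Eval e₁ s r₁)
      (h₂ : Eval (ε.second e r₁.1) r₁.2 r₂) : Eval e s (ε.comb e r₁.1 r₂)

variable {ε}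

theorem evaln_mono {k k' : ℕ} (hk : k ≤ k') {e : E} {s : S} {r : V × S}
    (h : ε.evaln k e s = some r) : ε.evaln k' e s = some r := by
  induction k generalizing k' e s r with
  | zero => simp [evaln] at h
  | succ k ih =>
    obtain ⟨k', rfl⟩ := Nat.exists_eq_add_of_le' hk
    rw [← Nat.add_assoc]
    unfold evaln at h ⊢
    cases he : ε.first e with
    | none => simpa [he] using h
    | some e₁ =>
      simp only [he, Option.bind_eq_some_iff, Option.map_eq_some_iff] at h ⊢
      obtain ⟨r₁, h₁, r₂, h₂, hr⟩ := h
      exact ⟨r₁, ih (by omega) h₁, r₂, ih (by omega) h₂, hr⟩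

/-- A derivation is finite, so some depth suffices for it; by `evaln_mono` the two branches of a
node can share the larger depth. -/
theorem eval_iff {e : E} {s : S} {r : V × S} :
    ε.Eval e s r ↔ ∃ k, ε.evaln k e s = some r := by
  constructor
  · intro h
    induction h with
    | leaf h hr => exact ⟨1, by simp [evaln, h, hr]⟩
    | node h _ _ ih₁ ih₂ =>
      obtain ⟨k₁, h₁⟩ := ih₁
      obtain ⟨k₂, h₂⟩ := ih₂
      refine ⟨max k₁ k₂ + 1, ?_⟩
      simp [evaln, h, evaln_mono (le_max_left k₁ k₂) h₁, evaln_mono (le_max_right k₁ k₂) h₂]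
  · rintro ⟨k, h⟩
    induction k generalizing e s r with
    | zero => simp [evaln] at h
    | succ k ih =>
      unfold evaln at h
      cases he : ε.first e with
      | none => exact .leaf he (by simpa [he] using h)
      | some e₁ =>
        simp only [he, Option.bind_eq_some_iff, Option.map_eq_some_iff] at h
        obtain ⟨r₁, h₁, r₂, h₂, rfl⟩ := h
        exact .node he (ih h₁) (ih h₂)

theorem eval_leaf {e : E} {s : S} {r : V × S} (h : ε.first e = none) :
    ε.Eval e s r ↔ ε.leaf e s = some r :=
  ⟨fun h' => by cases h' with
    | leaf _ hr => exact hr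
    | node h' => simp_all, .leaf h⟩

theorem eval_node {e e₁ : E} {s : S} {r : V × S} (h : ε.first e = some e₁) :
    ε.Eval e s r ↔ ∃ r₁ r₂, ε.Eval e₁ s r₁ ∧ ε.Eval (ε.second e r₁.1) r₁.2 r₂ ∧
      r = ε.comb e r₁.1 r₂ := by
  constructor
  · intro h'
    cases h' with
    | leaf h' => simp_all
    | node h' h₁ h₂ =>
      obtain rfl := Option.some.inj (h.symm.trans h')
      exact ⟨_, _, h₁, h₂, rfl⟩
  · rintro ⟨r₁, r₂, h₁, h₂, rfl⟩
    exact .node h h₁ h₂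

open Nat.Partrec (Code)

theorem _root_.Computable.comp₃ {α β γ δ σ : Type*} [Primcodable α] [Primcodable β]
    [Primcodable γ] [Primcodable δ] [Primcodable σ] {f : β → γ → δ → σ} {g₁ : α → β} {g₂ : α → γ}
    {g₃ : α → δ} (hf : Computable fun p : (β × γ) × δ => f p.1.1 p.1.2 p.2)
    (h₁ : Computable g₁) (h₂ : Computable g₂) (h₃ : Computable g₃) :
    Computable fun a => f (g₁ a) (g₂ a) (g₃ a) :=
  hf.comp ((h₁.pair h₂).pair h₃)

/-- The recursion is nested: the second call depends on the result of the first one, and the state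
changes between them. So a single step is written with its recursive calls made to an arbitrary code
`c`, and the recursion theorem supplies a `c` that computes its own step. -/
theorem computable_evaln [Primcodable E] [Primcodable S] [Primcodable V]
    (hleaf : Computable₂ ε.leaf) (hfirst : Computable ε.first)
    (hsecond : Computable₂ ε.second)
    (hcomb : Computable fun p : (E × V) × V × S => ε.comb p.1.1 p.1.2 p.2) :
    Computable fun i : ℕ × E × S => ε.evaln i.1 i.2.1 i.2.2 := by
  let call : Code → ℕ × E × S →. Option (V × S) := fun c i =>
    (c.eval (Encodable.encode i)).bind fun n =>
      ((Encodable.decode n : Option (Option (V × S))) : Part (Option (V × S)))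
  have hcall : Partrec₂ call :=
    (Code.eval_part.comp Computable.fst (Computable.encode.comp Computable.snd)).bind
      (Computable.ofOption (Computable.decode.comp Computable.snd))
  -- `step₂` evaluates the second argument from the result of the first one, `step₁` evaluates the
  -- first argument and passes its result on, and `step` distinguishes leaves from nodes.
  let step₂ : (Code × ℕ × E × S) × V × S →. Option (V × S) := fun p =>
    (call p.1.1 (p.1.2.1, ε.second p.1.2.2.1 p.2.1, p.2.2)).map fun o =>
      o.map (ε.comb p.1.2.2.1 p.2.1)
  have hstep₂ : Partrec step₂ := by
    have he : Computable fun p : (Code × ℕ × E × S) × V × S => p.1.2.2.1 :=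
      Computable.fst.comp (Computable.snd.comp (Computable.snd.comp Computable.fst))
    have hv : Computable fun p : (Code × ℕ × E × S) × V × S => p.2.1 :=
      Computable.fst.comp Computable.snd
    have hk : Computable fun p : (Code × ℕ × E × S) × V × S => p.1.2.1 :=
      Computable.fst.comp (Computable.snd.comp Computable.fst)
    have hp : Computable fun q : (((Code × ℕ × E × S) × V × S) × Option (V × S)) × V × S =>
        q.1.1 := Computable.fst.comp Computable.fst
    have hcomb' : Computable fun q : (((Code × ℕ × E × S) × V × S) × Option (V × S)) × V × S =>
        ε.comb q.1.1.1.2.2.1 q.1.1.2.1 q.2 :=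
      hcomb.comp₃ (he.comp hp) (hv.comp hp) Computable.snd
    have hmap : Computable₂ fun (p : (Code × ℕ × E × S) × V × S) (o : Option (V × S)) =>
        o.map (ε.comb p.1.2.2.1 p.2.1) :=
      Computable.option_map (f := fun q : ((Code × ℕ × E × S) × V × S) × Option (V × S) => q.2)
        (g := fun q r => ε.comb q.1.1.2.2.1 q.1.2.1 r) Computable.snd hcomb'.to₂
    exact Partrec.map (hcall.comp (Computable.fst.comp Computable.fst)
      (hk.pair ((hsecond.comp he hv).pair (Computable.snd.comp Computable.snd)))) hmap
  let step₁ : (Code × ℕ × E × S) × E →. Option (V × S) := fun p =>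
    (call p.1.1 (p.1.2.1, p.2, p.1.2.2.2)).bind fun o =>
      Option.casesOn o (Part.some none) fun r => step₂ (p.1, r)
  have hstep₁ : Partrec step₁ := by
    have hk : Computable fun p : (Code × ℕ × E × S) × E => p.1.2.1 :=
      Computable.fst.comp (Computable.snd.comp Computable.fst)
    have hs : Computable fun p : (Code × ℕ × E × S) × E => p.1.2.2.2 :=
      Computable.snd.comp (Computable.snd.comp (Computable.snd.comp Computable.fst))
    refine Partrec.bind (hcall.comp (Computable.fst.comp Computable.fst)
      (hk.pair (Computable.snd.pair hs))) ?_
    exact Partrec.optionCasesOn_right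
      (o := fun p : ((Code × ℕ × E × S) × E) × Option (V × S) => p.2)
      (f := fun _ => none) (g := fun p r => step₂ (p.1.1, r))
      Computable.snd (Computable.const none)
      (hstep₂.comp ((Computable.fst.comp (Computable.fst.comp Computable.fst)).pair
        Computable.snd))
  let step : Code → ℕ × E × S →. Option (V × S) := fun c i =>
    Nat.casesOn i.1 (Part.some none) fun k =>
      Option.casesOn (ε.first i.2.1) (Part.some (ε.leaf i.2.1 i.2.2)) fun e₁ =>
        step₁ ((c, k, i.2), e₁)
  have hstep : Partrec₂ step := by
    have he : Computable fun p : (Code × ℕ × E × S) × ℕ => p.1.2.2.1 :=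
      Computable.fst.comp (Computable.snd.comp (Computable.snd.comp Computable.fst))
    have hs : Computable fun p : (Code × ℕ × E × S) × ℕ => p.1.2.2.2 :=
      Computable.snd.comp (Computable.snd.comp (Computable.snd.comp Computable.fst))
    refine Partrec.nat_casesOn_right (Computable.fst.comp Computable.snd)
      (Computable.const none) ?_
    exact Partrec.optionCasesOn_right
      (o := fun p : (Code × ℕ × E × S) × ℕ => ε.first p.1.2.2.1)
      (f := fun p => ε.leaf p.1.2.2.1 p.1.2.2.2)
      (g := fun p e₁ => step₁ ((p.1.1, p.2, p.1.2.2), e₁))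
      (hfirst.comp he) (hleaf.comp he hs)
      (hstep₁.comp (((Computable.fst.comp (Computable.fst.comp Computable.fst)).pair
        ((Computable.snd.comp Computable.fst).pair
          (Computable.snd.comp (Computable.snd.comp (Computable.fst.comp Computable.fst))))).pair
        Computable.snd))
  obtain ⟨c, hc⟩ := Code.fixed_point₂ (f := fun c n =>
    ((Encodable.decode n : Option (ℕ × E × S)) : Part (ℕ × E × S)).bind fun i =>
      (step c i).map Encodable.encode) <| by
    refine Partrec.bind (Computable.ofOption (Computable.decode.comp Computable.snd)) ?_
    exact Partrec.map (hstep.comp (Computable.fst.comp Computable.fst) Computable.snd)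
      (Computable.encode.comp Computable.snd)
  have heval : ∀ i, c.eval (Encodable.encode i) = (step c i).map Encodable.encode := by
    intro i
    rw [hc]
    simp
  -- Recursive calls lower the depth, so induction on `k` shows that the partial function computed
  -- by `c` is total and equals `evaln`.
  have hcallc : ∀ k e s, call c (k, e, s) = Part.some (ε.evaln k e s) := by
    have h1 : ∀ i, call c i = step c i := by
      intro i
      simp only [call, heval, Part.bind_map, Encodable.encodek]
      exact Part.bind_some_right _
    intro k
    induction k with
    | zero => exact fun e s => h1 _
    | succ k ih =>
      intro e s
      rw [h1]
      simp only [step, step₁, step₂, evaln]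
      cases ε.first e with
      | none => rfl
      | some e₁ =>
        simp only [ih, Part.bind_some]
        cases ε.evaln k e₁ s with
        | none => rfl
        | some r₁ => simp
  exact (hcall.comp (Computable.const c) Computable.id).of_eq_tot fun i => by
    rw [id, hcallc i.1 i.2.1 i.2.2]
    exact Part.mem_some _

end Evaluator

/-! ### The inverses of the tupling functions -/

/-- The successor in the enumeration of pairs. -/
def nextPair (p : ℕ × ℕ) : ℕ × ℕ := if p.2 = 0 then (0, p.1 + 1) else (p.1 + 1, p.2 - 1)

/-- The successor in the enumeration of triples. -/
def nextTriple (t : ℕ × ℕ × ℕ) : ℕ × ℕ × ℕ :=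
  if t.2.1 = 0 then (if t.2.2 = 0 then (0, 0, t.1 + 1) else (0, t.1 + 1, t.2.2 - 1))
  else (t.1 + 1, t.2.1 - 1, t.2.2)

/-- The inverse of Cantor's pairing function. -/
def unpair (n : ℕ) : ℕ × ℕ := nextPair^[n] (0, 0)

/-- The inverse of Cantor's tupling function for triples. -/
def untriple (n : ℕ) : ℕ × ℕ × ℕ := nextTriple^[n] (0, 0, 0)

/-- On an antidiagonal the binomial coefficient is constant and `x` grows by one. At its end,
`choose_two_step` accounts for the jump to the next antidiagonal. -/
theorem pair_nextPair (x y : ℕ) :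
    pair (nextPair (x, y)).1 (nextPair (x, y)).2 = pair x y + 1 := by
  rcases y with _ | y
  · have := choose_two_step x
    simp only [nextPair, pair, if_true]
    simp only [Nat.zero_add, Nat.add_zero] at *
    omega
  · simp only [nextPair, pair, Nat.add_one_ne_zero, if_false, Nat.add_sub_cancel]
    rw [show x + 1 + y = x + (y + 1) by omega]
    omega

theorem triple_nextTriple (x y z : ℕ) :
    triple (nextTriple (x, y, z)).1 (nextTriple (x, y, z)).2.1 (nextTriple (x, y, z)).2.2 =
      triple x y z + 1 := by
  rcases y with _ | y
  · rcases z with _ | z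
    · have h2 := choose_three_step x
      have h3 := choose_two_step x
      simp only [nextTriple, triple, if_true, Nat.zero_add, Nat.add_zero] at *
      rw [show Nat.choose 1 2 = 0 from rfl, h2, h3]
      omega
    · have h3 := choose_two_step x
      simp only [nextTriple, triple, if_true, Nat.add_one_ne_zero, if_false, Nat.zero_add,
        Nat.add_zero, Nat.add_sub_cancel] at *
      rw [show x + 1 + z = x + (z + 1) by omega]
      omega
  · simp only [nextTriple, triple, Nat.add_one_ne_zero, if_false, Nat.add_sub_cancel]
    rw [show x + 1 + y = x + (y + 1) by omega]
    omega

theorem pair_unpair (n : ℕ) : pair (unpair n).1 (unpair n).2 = n := by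
  induction n with
  | zero => rfl
  | succ n ih =>
    rw [unpair, Function.iterate_succ_apply', ← unpair, pair_nextPair, ih]

theorem triple_untriple (n : ℕ) :
    triple (untriple n).1 (untriple n).2.1 (untriple n).2.2 = n := by
  induction n with
  | zero => rfl
  | succ n ih =>
    rw [untriple, Function.iterate_succ_apply', ← untriple, triple_nextTriple, ih]

/-- A right inverse of an injective function is also a left inverse. -/
theorem unpair_pair (x y : ℕ) : unpair (pair x y) = (x, y) :=
  have h := pair_inj (pair_unpair (pair x y))
  Prod.ext h.1 h.2

theorem untriple_triple (x y z : ℕ) : untriple (triple x y z) = (x, y, z) :=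
  have h := triple_inj (triple_untriple (triple x y z))
  Prod.ext h.1 (Prod.ext h.2.1 h.2.2)

open Primrec in
theorem primrec_nextPair : Primrec nextPair := by
  refine Primrec.ite (Primrec.eq.comp snd (const 0)) ?_ ?_
  · exact (const 0).pair (succ.comp fst)
  · exact (succ.comp fst).pair (pred.comp snd)

open Primrec in
theorem primrec_nextTriple : Primrec nextTriple := by
  have h1 : Primrec fun t : ℕ × ℕ × ℕ => t.2.1 := fst.comp snd
  have h2 : Primrec fun t : ℕ × ℕ × ℕ => t.2.2 := snd.comp snd
  refine Primrec.ite (Primrec.eq.comp h1 (const 0))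
    (Primrec.ite (Primrec.eq.comp h2 (const 0)) ?_ ?_) ?_
  · exact (const 0).pair ((const 0).pair (succ.comp fst))
  · exact (const 0).pair ((succ.comp fst).pair (pred.comp h2))
  · exact (succ.comp fst).pair ((pred.comp h1).pair h2)

/-- Defining the inverse as an iterated successor makes primitive recursiveness immediate; no
binomial coefficient has to be inverted. -/
theorem primrec_unpair : Primrec unpair :=
  Primrec.nat_iterate Primrec.id (Primrec.const (0, 0)) (primrec_nextPair.comp Primrec.snd).to₂

theorem primrec_untriple : Primrec untriple :=
  Primrec.nat_iterate Primrec.id (Primrec.const (0, 0, 0))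
    (primrec_nextTriple.comp Primrec.snd).to₂

theorem primrec_pair : Primrec₂ pair := by
  have h : Primrec₂ fun x y : ℕ => x + (x + y + 1) * (x + y) / 2 :=
    Primrec.nat_add.comp Primrec.fst (Primrec.nat_div.comp (Primrec.nat_mul.comp
      (Primrec.succ.comp (Primrec.nat_add.comp Primrec.fst Primrec.snd))
      (Primrec.nat_add.comp Primrec.fst Primrec.snd)) (Primrec.const 2))
  exact h.of_eq fun x y => by rw [pair, Nat.choose_two_right, Nat.add_sub_cancel]

/-! ### An interpreter -/

/-- The content of a memory location, for a memory given by the list of the assignments, the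
last one first. -/
def look (l : List (ℕ × ℕ)) (i : ℕ) : ℕ := (l.lookup i).getD 0

theorem look_cons (l : List (ℕ × ℕ)) (i v : ℕ) :
    look ((i, v) :: l) = Function.update (look l) i v := by
  funext j
  simp only [look, List.lookup_cons, Function.update_apply]
  by_cases h : j = i
  · simp [h]
  · simp [h, beq_false_of_ne h]

/-- The rule for the expression with code `e = (c, n)`; the syntactic category `c` is `0` for
arithmetic expressions, `1` for boolean expressions, and `2` for sentences. -/
def rule (e : ℕ × ℕ) : ℕ :=
  -- In the order of the grammar, the rules have the numbers `0`–`5` for arithmetic expressions,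
  -- `6`–`12` for boolean expressions and `13`–`17` for sentences. The lists below are indexed by
  -- these numbers.
  [if e.2 = 0 then 0 else (e.2 - 1) % 5 + 1, if e.2 < 2 then e.2 + 6 else (e.2 - 2) % 5 + 8,
    if e.2 = 0 then 13 else (e.2 - 1) % 4 + 14].getD e.1 0

/-- The code of the arguments of the expression with code `e`. -/
def args (e : ℕ × ℕ) : ℕ :=
  [(e.2 - 1) / 5, (e.2 - 2) / 5, (e.2 - 1) / 4].getD e.1 0

/-- The first argument to be evaluated. -/
def firstArg (e : ℕ × ℕ) : Option (ℕ × ℕ) :=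
  [none, none, none, some (0, (unpair (args e)).1), some (0, (unpair (args e)).1),
    some (0, (unpair (args e)).1), none, none, some (0, (unpair (args e)).1),
    some (0, (unpair (args e)).1), some (1, (unpair (args e)).1), some (1, (unpair (args e)).1),
    some (1, args e), none, some (0, (unpair (args e)).2), some (1, (unpair (args e)).1),
    some (2, (unpair (args e)).1), some (1, (untriple (args e)).1)].getD (rule e) none

/-- The second argument to be evaluated, when the value of the first one is `v`. If there is
none, it is a constant or `skip`. -/
def secondArg (e : ℕ × ℕ) (v : ℕ) : ℕ × ℕ :=
  [(0, 0), (0, 0), (0, 0), (0, (unpair (args e)).2), (0, (unpair (args e)).2),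
    (0, (unpair (args e)).2), (0, 0), (0, 0), (0, (unpair (args e)).2), (0, (unpair (args e)).2),
    -- Short-circuit evaluation: when the second argument of `and` / `or` is not needed, the
    -- constant `false` / `true` takes its place.
    if v = 0 then (1, 1) else (1, (unpair (args e)).2),
    if v = 0 then (1, (unpair (args e)).2) else (1, 0), (1, 0), (2, 0), (2, 0),
    -- A loop with true condition is unfolded into the code of body followed by loop; `e.2` is the
    -- code of the loop itself.
    if v = 0 then (2, 0) else (2, 4 * pair (unpair (args e)).2 e.2 + 3),
    (2, (unpair (args e)).2),
    if v = 0 then (2, (untriple (args e)).2.2) else (2, (untriple (args e)).2.1)].getD (rule e)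
      (0, 0)

/-- The result, when the value of the first argument is `v` and the result of the second one
is `r`. -/
def combine (e : ℕ × ℕ) (v : ℕ) (r : ℕ × List (ℕ × ℕ) × List Bool) :
    ℕ × List (ℕ × ℕ) × List Bool :=
  -- Sentences lie beyond the end of the list and get the dummy value `0`.
  ([0, 0, 0, v + r.1, v - r.1, v * r.1, 0, 0, if v = r.1 then 1 else 0,
      if v < r.1 then 1 else 0, r.1, r.1, 1 - v].getD (rule e) 0,
    if rule e = 14 then ((unpair (args e)).1, v) :: r.2.1 else r.2.1, r.2.2)

/-- The result of an expression without arguments that are to be evaluated. -/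
def evalLeaf (e : ℕ × ℕ) (s : List (ℕ × ℕ) × List Bool) :
    Option (ℕ × List (ℕ × ℕ) × List Bool) :=
  -- On empty input `head?` yields failure. The default `(0, s)` serves both `false` and `skip`.
  [s.2.head?.map fun d => (d.toNat, s.1, s.2.tail), some (args e, s), some (look s.1 (args e), s),
    none, none, none, some (1, s)].getD (rule e) (some (0, s))

/-- The interpreter. -/
def interpreter : Evaluator (ℕ × ℕ) (List (ℕ × ℕ) × List Bool) ℕ where
  leaf := evalLeaf
  first := firstArg
  second := secondArg
  comb := combine

section
open Primrec

theorem primrec_look : Primrec₂ look :=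
  option_getD.comp (listLookup.comp snd fst) (const 0)

theorem primrec_rule : Primrec rule := by
  refine (list_getD 0).comp (list_cons.comp ?_ (list_cons.comp ?_ (list_cons.comp ?_ (const []))))
    fst
  · exact Primrec.ite (Primrec.eq.comp snd (const 0)) (const 0)
      (succ.comp (nat_mod.comp (pred.comp snd) (const 5)))
  · exact Primrec.ite (nat_lt.comp snd (const 2)) (nat_add.comp snd (const 6))
      (nat_add.comp (nat_mod.comp (nat_sub.comp snd (const 2)) (const 5)) (const 8))
  · exact Primrec.ite (Primrec.eq.comp snd (const 0)) (const 13)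
      (nat_add.comp (nat_mod.comp (pred.comp snd) (const 4)) (const 14))

theorem primrec_args : Primrec args := by
  refine (list_getD 0).comp (list_cons.comp ?_ (list_cons.comp ?_ (list_cons.comp ?_ (const []))))
    fst
  · exact nat_div.comp (pred.comp snd) (const 5)
  · exact nat_div.comp (nat_sub.comp snd (const 2)) (const 5)
  · exact nat_div.comp (pred.comp snd) (const 4)

theorem primrec_firstArg : Primrec firstArg := by
  have h1 := fst.comp (primrec_unpair.comp primrec_args)
  have h2 := snd.comp (primrec_unpair.comp primrec_args)
  have h3 := fst.comp (primrec_untriple.comp primrec_args)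
  have c (k : ℕ) {g : ℕ × ℕ → ℕ} (hg : Primrec g) : Primrec fun e => some (k, g e) :=
    option_some.comp ((const k).pair hg)
  have n : Primrec fun _ : ℕ × ℕ => (none : Option (ℕ × ℕ)) := const none
  exact (list_getD none).comp (list_cons.comp n <| list_cons.comp n <| list_cons.comp n <|
    list_cons.comp (c 0 h1) <| list_cons.comp (c 0 h1) <| list_cons.comp (c 0 h1) <|
    list_cons.comp n <| list_cons.comp n <|
    list_cons.comp (c 0 h1) <| list_cons.comp (c 0 h1) <|
    list_cons.comp (c 1 h1) <| list_cons.comp (c 1 h1) <| list_cons.comp (c 1 primrec_args) <|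
    list_cons.comp n <| list_cons.comp (c 0 h2) <| list_cons.comp (c 1 h1) <|
    list_cons.comp (c 2 h1) <| list_cons.comp (c 1 h3) (const [])) primrec_rule

theorem primrec_secondArg : Primrec₂ secondArg := by
  have ha : Primrec fun p : (ℕ × ℕ) × ℕ => args p.1 := primrec_args.comp fst
  have h2 := snd.comp (primrec_unpair.comp ha)
  have h3 := fst.comp (snd.comp (primrec_untriple.comp ha))
  have h4 := snd.comp (snd.comp (primrec_untriple.comp ha))
  have c (k : ℕ) {g : (ℕ × ℕ) × ℕ → ℕ} (hg : Primrec g) : Primrec fun e => (k, g e) :=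
    (const k).pair hg
  have n : Primrec fun _ : (ℕ × ℕ) × ℕ => (0, 0) := const (0, 0)
  have i {f g : (ℕ × ℕ) × ℕ → ℕ × ℕ} (hf : Primrec f) (hg : Primrec g) :
      Primrec fun p => if p.2 = 0 then f p else g p :=
    Primrec.ite (Primrec.eq.comp snd (const 0)) hf hg
  have hw : Primrec fun p : (ℕ × ℕ) × ℕ => 4 * pair (unpair (args p.1)).2 p.1.2 + 3 :=
    nat_add.comp (nat_mul.comp (const 4) (primrec_pair.comp h2 (snd.comp fst))) (const 3)
  exact (list_getD (0, 0)).comp (list_cons.comp n <| list_cons.comp n <| list_cons.comp n <|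
    list_cons.comp (c 0 h2) <| list_cons.comp (c 0 h2) <| list_cons.comp (c 0 h2) <|
    list_cons.comp n <| list_cons.comp n <|
    list_cons.comp (c 0 h2) <| list_cons.comp (c 0 h2) <|
    list_cons.comp (i (const (1, 1)) (c 1 h2)) <| list_cons.comp (i (c 1 h2) (const (1, 0))) <|
    list_cons.comp (const (1, 0)) <| list_cons.comp (const (2, 0)) <|
    list_cons.comp (const (2, 0)) <| list_cons.comp (i (const (2, 0)) (c 2 hw)) <|
    list_cons.comp (c 2 h2) <| list_cons.comp (i (c 2 h4) (c 2 h3)) (const []))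
    (primrec_rule.comp fst)

theorem primrec_combine : Primrec
    fun p : ((ℕ × ℕ) × ℕ) × ℕ × List (ℕ × ℕ) × List Bool => combine p.1.1 p.1.2 p.2 := by
  have he : Primrec fun p : ((ℕ × ℕ) × ℕ) × ℕ × List (ℕ × ℕ) × List Bool => p.1.1 :=
    fst.comp fst
  have hv : Primrec fun p : ((ℕ × ℕ) × ℕ) × ℕ × List (ℕ × ℕ) × List Bool => p.1.2 :=
    snd.comp fst
  have hr : Primrec fun p : ((ℕ × ℕ) × ℕ) × ℕ × List (ℕ × ℕ) × List Bool => p.2.1 :=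
    fst.comp snd
  have hl : Primrec fun p : ((ℕ × ℕ) × ℕ) × ℕ × List (ℕ × ℕ) × List Bool => p.2.2.1 :=
    fst.comp (snd.comp snd)
  have hc := primrec_rule.comp he
  have n : Primrec fun _ : ((ℕ × ℕ) × ℕ) × ℕ × List (ℕ × ℕ) × List Bool => 0 := const 0
  refine Primrec.pair ?_ (Primrec.pair ?_ (snd.comp (snd.comp snd)))
  · exact (list_getD 0).comp (list_cons.comp n <| list_cons.comp n <| list_cons.comp n <|
      list_cons.comp (nat_add.comp hv hr) <| list_cons.comp (nat_sub.comp hv hr) <|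
      list_cons.comp (nat_mul.comp hv hr) <| list_cons.comp n <| list_cons.comp n <|
      list_cons.comp (Primrec.ite (Primrec.eq.comp hv hr) (const 1) n) <|
      list_cons.comp (Primrec.ite (nat_lt.comp hv hr) (const 1) n) <|
      list_cons.comp hr <| list_cons.comp hr <|
      list_cons.comp (nat_sub.comp (const 1) hv) (const [])) hc
  · exact Primrec.ite (Primrec.eq.comp hc (const 14))
      (list_cons.comp ((fst.comp (primrec_unpair.comp (primrec_args.comp he))).pair hv) hl) hl

theorem primrec_evalLeaf : Primrec₂ evalLeaf := by
  have he : Primrec fun p : (ℕ × ℕ) × List (ℕ × ℕ) × List Bool => p.1 := fst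
  have hs : Primrec fun p : (ℕ × ℕ) × List (ℕ × ℕ) × List Bool => p.2 := snd
  have ha := primrec_args.comp he
  have n : Primrec fun _ : (ℕ × ℕ) × List (ℕ × ℕ) × List Bool =>
    (none : Option (ℕ × List (ℕ × ℕ) × List Bool)) := const none
  have hread : Primrec fun p : (ℕ × ℕ) × List (ℕ × ℕ) × List Bool =>
      p.2.2.head?.map fun d => (d.toNat, p.2.1, p.2.2.tail) := by
    refine option_map (list_head?.comp (snd.comp hs)) ?_
    exact ((dom_bool Bool.toNat).comp snd).pair
      ((fst.comp (hs.comp fst)).pair (list_tail.comp (snd.comp (hs.comp fst))))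
  have hd : Primrec fun p : (ℕ × ℕ) × List (ℕ × ℕ) × List Bool => some (0, p.2) :=
    option_some.comp ((const 0).pair hs)
  exact option_getD.comp (list_getElem?.comp (list_cons.comp hread <|
    list_cons.comp (option_some.comp (ha.pair hs)) <|
    list_cons.comp (option_some.comp ((primrec_look.comp (fst.comp hs) ha).pair hs)) <|
    list_cons.comp n <| list_cons.comp n <| list_cons.comp n <|
    list_cons.comp (option_some.comp ((const 1).pair hs)) (const [])) (primrec_rule.comp he)) hd

theorem computable_interpreter : Computable fun i : ℕ × (ℕ × ℕ) × List (ℕ × ℕ) × List Bool =>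
    interpreter.evaln i.1 i.2.1 i.2.2 :=
  Evaluator.computable_evaln primrec_evalLeaf.to_comp primrec_firstArg.to_comp
    primrec_secondArg.to_comp primrec_combine.to_comp

end

/-! ### Correctness of the interpreter -/

theorem rule_aexp (k : ℕ) {j : ℕ} (hj : j < 5) : rule (0, 5 * k + (j + 1)) = j + 1 := by
  simp only [rule, List.getD_cons_zero]
  rw [if_neg (by omega)]
  omega

theorem args_aexp (k : ℕ) {j : ℕ} (hj : j < 5) : args (0, 5 * k + (j + 1)) = k := by
  simp only [args, List.getD_cons_zero]
  omega

theorem rule_bexp (k : ℕ) {j : ℕ} (hj : j < 5) : rule (1, 5 * k + (j + 2)) = j + 8 := by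
  simp only [rule, List.getD_cons_zero, List.getD_cons_succ]
  rw [if_neg (by omega)]
  omega

theorem args_bexp (k : ℕ) {j : ℕ} (hj : j < 5) : args (1, 5 * k + (j + 2)) = k := by
  simp only [args, List.getD_cons_zero, List.getD_cons_succ]
  omega

theorem rule_sentence (k : ℕ) {j : ℕ} (hj : j < 4) : rule (2, 4 * k + (j + 1)) = j + 14 := by
  simp only [rule, List.getD_cons_zero, List.getD_cons_succ]
  rw [if_neg (by omega)]
  omega

theorem args_sentence (k : ℕ) {j : ℕ} (hj : j < 4) : args (2, 4 * k + (j + 1)) = k := by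
  simp only [args, List.getD_cons_zero, List.getD_cons_succ]
  omega

/-- The state represented by a list of assignments and the unread input. -/
def toState (s : List (ℕ × ℕ) × List Bool) : State := ⟨look s.1, s.2⟩

/-- The interpreter evaluates the expression `e` like `E`, up to the coding `c` of the values,
and leaves the memory unchanged. -/
def Evaluates {V : Type} (c : V → ℕ) (e : ℕ × ℕ) (E : State → Option (V × State)) : Prop :=
  (∀ l y r, interpreter.Eval e (l, y) r → r.2.1 = l ∧
      ∃ v, r.1 = c v ∧ E ⟨look l, y⟩ = some (v, ⟨look l, r.2.2⟩)) ∧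
    ∀ l y v t, E ⟨look l, y⟩ = some (v, t) →
      t.mem = look l ∧ interpreter.Eval e (l, y) (c v, l, t.input)

theorem Evaluates.leaf {V : Type} {c : V → ℕ} {e : ℕ × ℕ} {v : V}
    (h : interpreter.first e = none) (h' : ∀ s, interpreter.leaf e s = some (c v, s)) :
    Evaluates c e fun s => some (v, s) := by
  refine ⟨fun l y r hr => ?_, fun l y w t ht => ?_⟩
  · rw [Evaluator.eval_leaf h, h'] at hr
    obtain rfl := Option.some.inj hr
    exact ⟨rfl, v, rfl, rfl⟩
  · cases ht
    exact ⟨rfl, (Evaluator.eval_leaf h).2 (h' _)⟩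

/-- `E₂` may depend on the first value, which covers short-circuit evaluation. Expressions do not
write to memory, so one list `l` represents the memory throughout. -/
theorem Evaluates.node {V V₁ V₂ : Type} {c : V → ℕ} {c₁ : V₁ → ℕ} {c₂ : V₁ → V₂ → ℕ}
    {e e₁ : ℕ × ℕ} {E₁ : State → Option (V₁ × State)} {E₂ : V₁ → State → Option (V₂ × State)}
    {f : V₁ → V₂ → V} (h : interpreter.first e = some e₁) (h₁ : Evaluates c₁ e₁ E₁)
    (h₂ : ∀ v, Evaluates (c₂ v) (interpreter.second e (c₁ v)) (E₂ v))
    (hc : ∀ v w s, interpreter.comb e (c₁ v) (c₂ v w, s) = (c (f v w), s)) :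
    Evaluates c e fun s => (E₁ s).bind fun r => (E₂ r.1 r.2).map fun r' => (f r.1 r'.1, r'.2) := by
  refine ⟨fun l y r hr => ?_, fun l y v t ht => ?_⟩
  · obtain ⟨⟨r₁, l₁, y₁⟩, ⟨r₂, l₂, y₂⟩, hr₁, hr₂, rfl⟩ := (Evaluator.eval_node h).1 hr
    obtain ⟨rfl, v₁, rfl, e₁⟩ := h₁.1 _ _ _ hr₁
    obtain ⟨rfl, v₂, rfl, e₂⟩ := (h₂ v₁).1 _ _ _ hr₂
    rw [hc]
    exact ⟨rfl, f v₁ v₂, rfl, by simp [e₁, e₂]⟩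
  · simp only [Option.bind_eq_some_iff, Option.map_eq_some_iff, Prod.exists, Prod.mk.injEq] at ht
    obtain ⟨v₁, s₁, e₁, v₂, s₂, e₂, rfl, rfl⟩ := ht
    obtain ⟨hm, hr₁⟩ := h₁.2 _ _ _ _ e₁
    rw [show s₁ = ⟨look l, s₁.input⟩ by rw [← hm]] at e₂
    obtain ⟨hm₂, hr₂⟩ := (h₂ v₁).2 _ _ _ _ e₂
    refine ⟨hm₂, ?_⟩
    have := (Evaluator.eval_node h).2 ⟨_, _, hr₁, hr₂, rfl⟩
    rwa [hc] at this

theorem Evaluates.congr {V : Type} {c : V → ℕ} {e : ℕ × ℕ} {E E' : State → Option (V × State)}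
    (h : Evaluates c e E) (hE : ∀ s, E' s = E s) : Evaluates c e E' := funext hE ▸ h

theorem evaluates_aexp (a : AExp) : Evaluates id (0, a.rank) a.eval := by
  induction a with
  | readbit =>
    have h : interpreter.first (0, AExp.readbit.rank) = none := rfl
    refine ⟨fun l y r hr => ?_, fun l y v t ht => ?_⟩
    · rw [Evaluator.eval_leaf h] at hr
      cases y <;> simp [interpreter, evalLeaf, rule, AExp.rank] at hr
      subst hr
      simp [AExp.eval]
    · rw [Evaluator.eval_leaf h]
      cases y <;> simp [AExp.eval] at ht
      obtain ⟨rfl, rfl⟩ := ht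
      simp [interpreter, evalLeaf, rule, AExp.rank]
  | num n =>
    have hr : rule (0, (AExp.num n).rank) = 1 := rule_aexp n (j := 0) (by omega)
    have ha : args (0, (AExp.num n).rank) = n := args_aexp n (j := 0) (by omega)
    exact .leaf (by simp [interpreter, firstArg, hr])
      (by simp [interpreter, evalLeaf, hr, ha])
  | loc n =>
    have hr : rule (0, (AExp.loc n).rank) = 2 := rule_aexp n (j := 1) (by omega)
    have ha : args (0, (AExp.loc n).rank) = n := args_aexp n (j := 1) (by omega)
    have h : interpreter.first (0, (AExp.loc n).rank) = none := by
      simp [interpreter, firstArg, hr]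
    refine ⟨fun l y r hr' => ?_, fun l y v t ht => ?_⟩
    · rw [Evaluator.eval_leaf h] at hr'
      simp [interpreter, evalLeaf, hr, ha] at hr'
      subst hr'
      simp [AExp.eval]
    · rw [Evaluator.eval_leaf h]
      cases ht
      simp [interpreter, evalLeaf, hr, ha]
  | add a₁ a₂ ih₁ ih₂ =>
    have hr : rule (0, (AExp.add a₁ a₂).rank) = 3 := rule_aexp _ (j := 2) (by omega)
    have ha : args (0, (AExp.add a₁ a₂).rank) = pair a₁.rank a₂.rank :=
      args_aexp _ (j := 2) (by omega)
    refine (Evaluates.node (f := fun v w => v + w) (c₂ := fun _ => id)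
      (by simp [interpreter, firstArg, hr, ha, unpair_pair]) ih₁
      (fun v => by simpa [interpreter, secondArg, hr, ha, unpair_pair] using ih₂)
      (by simp [interpreter, combine, hr])).congr fun s => ?_
    simp [AExp.eval, Option.map_eq_bind]
  | sub a₁ a₂ ih₁ ih₂ =>
    have hr : rule (0, (AExp.sub a₁ a₂).rank) = 4 := rule_aexp _ (j := 3) (by omega)
    have ha : args (0, (AExp.sub a₁ a₂).rank) = pair a₁.rank a₂.rank :=
      args_aexp _ (j := 3) (by omega)
    refine (Evaluates.node (f := fun v w => v - w) (c₂ := fun _ => id)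
      (by simp [interpreter, firstArg, hr, ha, unpair_pair]) ih₁
      (fun v => by simpa [interpreter, secondArg, hr, ha, unpair_pair] using ih₂)
      (by simp [interpreter, combine, hr])).congr fun s => ?_
    simp [AExp.eval, Option.map_eq_bind]
  | mul a₁ a₂ ih₁ ih₂ =>
    have hr : rule (0, (AExp.mul a₁ a₂).rank) = 5 := rule_aexp _ (j := 4) (by omega)
    have ha : args (0, (AExp.mul a₁ a₂).rank) = pair a₁.rank a₂.rank :=
      args_aexp _ (j := 4) (by omega)
    refine (Evaluates.node (f := fun v w => v * w) (c₂ := fun _ => id)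
      (by simp [interpreter, firstArg, hr, ha, unpair_pair]) ih₁
      (fun v => by simpa [interpreter, secondArg, hr, ha, unpair_pair] using ih₂)
      (by simp [interpreter, combine, hr])).congr fun s => ?_
    simp [AExp.eval, Option.map_eq_bind]

theorem evaluates_true : Evaluates Bool.toNat (1, 0) fun s => some (true, s) :=
  .leaf rfl fun _ => rfl

theorem evaluates_false : Evaluates Bool.toNat (1, 1) fun s => some (false, s) :=
  .leaf rfl fun _ => rfl

theorem evaluates_bexp (b : BExp) : Evaluates Bool.toNat (1, b.rank) b.eval := by
  induction b with
  | tt => exact evaluates_true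
  | ff => exact evaluates_false
  | eq a₁ a₂ =>
    have hr : rule (1, (BExp.eq a₁ a₂).rank) = 8 := rule_bexp _ (j := 0) (by omega)
    have ha : args (1, (BExp.eq a₁ a₂).rank) = pair a₁.rank a₂.rank :=
      args_bexp _ (j := 0) (by omega)
    refine (Evaluates.node (f := fun v w => decide (v = w)) (c₂ := fun _ => id)
      (by simp [interpreter, firstArg, hr, ha, unpair_pair]) (evaluates_aexp a₁)
      (fun v => by
        simpa [interpreter, secondArg, hr, ha, unpair_pair] using evaluates_aexp a₂)
      (fun v w s => by
        by_cases h : v = w <;> simp [interpreter, combine, hr, h])).congr fun s => ?_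
    simp [BExp.eval, Option.map_eq_bind]
  | lt a₁ a₂ =>
    have hr : rule (1, (BExp.lt a₁ a₂).rank) = 9 := rule_bexp _ (j := 1) (by omega)
    have ha : args (1, (BExp.lt a₁ a₂).rank) = pair a₁.rank a₂.rank :=
      args_bexp _ (j := 1) (by omega)
    refine (Evaluates.node (f := fun v w => decide (v < w)) (c₂ := fun _ => id)
      (by simp [interpreter, firstArg, hr, ha, unpair_pair]) (evaluates_aexp a₁)
      (fun v => by
        simpa [interpreter, secondArg, hr, ha, unpair_pair] using evaluates_aexp a₂)
      (fun v w s => by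
        by_cases h : v < w <;> simp [interpreter, combine, hr, h])).congr fun s => ?_
    simp [BExp.eval, Option.map_eq_bind]
  | and b₁ b₂ ih₁ ih₂ =>
    have hr : rule (1, (BExp.and b₁ b₂).rank) = 10 := rule_bexp _ (j := 2) (by omega)
    have ha : args (1, (BExp.and b₁ b₂).rank) = pair b₁.rank b₂.rank :=
      args_bexp _ (j := 2) (by omega)
    refine (Evaluates.node (f := fun _ w => w) (c₂ := fun _ => Bool.toNat)
      (E₂ := fun v s => if v then b₂.eval s else some (false, s))
      (by simp [interpreter, firstArg, hr, ha, unpair_pair]) ih₁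
      (fun v => by
        cases v
        · simpa [interpreter, secondArg, hr, ha, unpair_pair] using evaluates_false
        · simpa [interpreter, secondArg, hr, ha, unpair_pair] using ih₂)
      (by simp [interpreter, combine, hr])).congr fun s => ?_
    simp [BExp.eval]
  | or b₁ b₂ ih₁ ih₂ =>
    have hr : rule (1, (BExp.or b₁ b₂).rank) = 11 := rule_bexp _ (j := 3) (by omega)
    have ha : args (1, (BExp.or b₁ b₂).rank) = pair b₁.rank b₂.rank :=
      args_bexp _ (j := 3) (by omega)
    refine (Evaluates.node (f := fun _ w => w) (c₂ := fun _ => Bool.toNat)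
      (E₂ := fun v s => if v then some (true, s) else b₂.eval s)
      (by simp [interpreter, firstArg, hr, ha, unpair_pair]) ih₁
      (fun v => by
        cases v
        · simpa [interpreter, secondArg, hr, ha, unpair_pair] using ih₂
        · simpa [interpreter, secondArg, hr, ha, unpair_pair] using evaluates_true)
      (by simp [interpreter, combine, hr])).congr fun s => ?_
    simp [BExp.eval]
  | not b ih =>
    have hr : rule (1, b.not.rank) = 12 := rule_bexp _ (j := 4) (by omega)
    have ha : args (1, b.not.rank) = b.rank := args_bexp _ (j := 4) (by omega)
    -- A negation has one argument; the dummy second argument `true` is evaluated and its value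
    -- ignored.
    refine (Evaluates.node (f := fun v _ => !v) (c₂ := fun _ => Bool.toNat)
      (E₂ := fun _ s => some (true, s))
      (by simp [interpreter, firstArg, hr, ha]) ih
      (fun v => by simpa [interpreter, secondArg, hr] using evaluates_true)
      (by simp [interpreter, combine, hr])).congr fun s => ?_
    simp [BExp.eval, Option.map_eq_bind]

theorem rule_assign (n : ℕ) (a : AExp) : rule (2, (Sentence.assign n a).rank) = 14 ∧
    args (2, (Sentence.assign n a).rank) = pair n a.rank :=
  ⟨rule_sentence _ (j := 0) (by omega), args_sentence _ (j := 0) (by omega)⟩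

theorem rule_whileDo (b : BExp) (P : Sentence) : rule (2, (Sentence.whileDo b P).rank) = 15 ∧
    args (2, (Sentence.whileDo b P).rank) = pair b.rank P.rank :=
  ⟨rule_sentence _ (j := 1) (by omega), args_sentence _ (j := 1) (by omega)⟩

theorem rule_seq (P Q : Sentence) : rule (2, (Sentence.seq P Q).rank) = 16 ∧
    args (2, (Sentence.seq P Q).rank) = pair P.rank Q.rank :=
  ⟨rule_sentence _ (j := 2) (by omega), args_sentence _ (j := 2) (by omega)⟩

theorem rule_ite (b : BExp) (P Q : Sentence) : rule (2, (Sentence.ite b P Q).rank) = 17 ∧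
    args (2, (Sentence.ite b P Q).rank) = triple b.rank P.rank Q.rank :=
  ⟨rule_sentence _ (j := 3) (by omega), args_sentence _ (j := 3) (by omega)⟩

theorem second_whileDo (b : BExp) (P : Sentence) (c : Bool) :
    interpreter.second (2, (Sentence.whileDo b P).rank) c.toNat =
      (2, if c then (Sentence.seq P (.whileDo b P)).rank else Sentence.skip.rank) := by
  obtain ⟨hr, ha⟩ := rule_whileDo b P
  cases c <;> simp [interpreter, secondArg, hr, ha, unpair_pair] <;> rfl

theorem second_ite (b : BExp) (P Q : Sentence) (c : Bool) :
    interpreter.second (2, (Sentence.ite b P Q).rank) c.toNat =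
      (2, if c then P.rank else Q.rank) := by
  obtain ⟨hr, ha⟩ := rule_ite b P Q
  cases c <;> simp [interpreter, secondArg, hr, ha, untriple_triple]

theorem first_whileDo (b : BExp) (P : Sentence) :
    interpreter.first (2, (Sentence.whileDo b P).rank) = some (1, b.rank) := by
  obtain ⟨hr, ha⟩ := rule_whileDo b P
  simp [interpreter, firstArg, hr, ha, unpair_pair]

theorem first_ite (b : BExp) (P Q : Sentence) :
    interpreter.first (2, (Sentence.ite b P Q).rank) = some (1, b.rank) := by
  obtain ⟨hr, ha⟩ := rule_ite b P Q
  simp [interpreter, firstArg, hr, ha, untriple_triple]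

theorem first_seq (P Q : Sentence) :
    interpreter.first (2, (Sentence.seq P Q).rank) = some (2, P.rank) := by
  obtain ⟨hr, ha⟩ := rule_seq P Q
  simp [interpreter, firstArg, hr, ha, unpair_pair]

theorem second_seq (P Q : Sentence) (v : ℕ) :
    interpreter.second (2, (Sentence.seq P Q).rank) v = (2, Q.rank) := by
  obtain ⟨hr, ha⟩ := rule_seq P Q
  simp [interpreter, secondArg, hr, ha, unpair_pair]

theorem first_assign (n : ℕ) (a : AExp) :
    interpreter.first (2, (Sentence.assign n a).rank) = some (0, a.rank) := by
  obtain ⟨hr, ha⟩ := rule_assign n a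
  simp [interpreter, firstArg, hr, ha, unpair_pair]

theorem second_assign (n : ℕ) (a : AExp) (v : ℕ) :
    interpreter.second (2, (Sentence.assign n a).rank) v = (2, Sentence.skip.rank) := by
  obtain ⟨hr, ha⟩ := rule_assign n a
  simp only [interpreter, secondArg, hr]
  rfl

theorem comb_assign (n : ℕ) (a : AExp) (v : ℕ) (r : ℕ × List (ℕ × ℕ) × List Bool) :
    (interpreter.comb (2, (Sentence.assign n a).rank) v r).2 = ((n, v) :: r.2.1, r.2.2) := by
  obtain ⟨hr, ha⟩ := rule_assign n a
  simp [interpreter, combine, hr, ha, unpair_pair]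

theorem comb_snd {e : ℕ × ℕ} (h : rule e ≠ 14) (v : ℕ) (r : ℕ × List (ℕ × ℕ) × List Bool) :
    (interpreter.comb e v r).2 = r.2 := by
  simp [interpreter, combine, h]

theorem eval_skip_iff {s : List (ℕ × ℕ) × List Bool} {r : ℕ × List (ℕ × ℕ) × List Bool} :
    interpreter.Eval (2, Sentence.skip.rank) s r ↔ r = (0, s) := by
  rw [Evaluator.eval_leaf (by rfl)]
  simp [interpreter, evalLeaf, rule, Sentence.rank, eq_comm]

/-- What the interpreter does with the code of a sentence is an execution of that sentence. -/
theorem exec_of_eval {P : Sentence} {s : List (ℕ × ℕ) × List Bool}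
    {r : ℕ × List (ℕ × ℕ) × List Bool} (h : interpreter.Eval (2, P.rank) s r) :
    Exec P (toState s) (toState r.2) := by
  generalize he : (2, P.rank) = e at h
  induction h generalizing P with
  | leaf h hr =>
    subst he
    cases P with
    | skip =>
      rw [← Evaluator.eval_leaf h, eval_skip_iff] at hr
      exact hr ▸ .skip _
    | assign n a => simp [first_assign] at h
    | whileDo b P => simp [first_whileDo] at h
    | seq P Q => simp [first_seq] at h
    | ite b P Q => simp [first_ite] at h
  | @node _ _ s r₁ _ h h₁ h₂ ih₁ ih₂ =>
    subst he
    cases P with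
    | skip => cases h
    | assign n a =>
      rw [first_assign, Option.some.injEq] at h
      subst h
      rw [second_assign, eval_skip_iff] at h₂
      obtain ⟨hl, v, hv, ha⟩ := (evaluates_aexp a).1 _ _ _ h₁
      have := Exec.assign (n := n) ha
      rw [comb_assign, h₂, hl, hv]
      simpa only [toState, look_cons, id] using this
    | whileDo b P =>
      rw [first_whileDo, Option.some.injEq] at h
      subst h
      obtain ⟨hl, c, hc, hb⟩ := (evaluates_bexp b).1 _ _ _ h₁
      replace hb : b.eval (toState s) = some (c, toState r₁.2) := by
        rw [toState, toState, hl]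
        exact hb
      rw [hc, second_whileDo] at ih₂ h₂
      rw [comb_snd (by rw [(rule_whileDo b P).1]; omega)]
      cases c with
      | false =>
        obtain rfl := eval_skip_iff.1 h₂
        exact .while_false hb
      | true =>
        -- The unfolded loop is itself the code of a sentence, so the induction hypothesis applies
        -- to it, and its execution splits into body and loop.
        have := ih₂ (P := .seq P (.whileDo b P)) rfl
        cases this with
        | seq hP hw => exact .while_true hb hP hw
    | seq P Q =>
      rw [first_seq, Option.some.injEq] at h
      rw [second_seq] at ih₂
      rw [comb_snd (by rw [(rule_seq P Q).1]; omega)]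
      exact .seq (ih₁ h) (ih₂ rfl)
    | ite b P Q =>
      rw [first_ite, Option.some.injEq] at h
      subst h
      obtain ⟨hl, c, hc, hb⟩ := (evaluates_bexp b).1 _ _ _ h₁
      replace hb : b.eval (toState s) = some (c, toState r₁.2) := by
        rw [toState, toState, hl]
        exact hb
      rw [hc, second_ite] at ih₂
      rw [comb_snd (by rw [(rule_ite b P Q).1]; omega)]
      cases c with
      | false => exact .ite_false hb (ih₂ rfl)
      | true => exact .ite_true hb (ih₂ rfl)

/-- The interpreter performs every execution of a sentence. -/
theorem exists_eval_of_exec {P : Sentence} {t t' : State} (h : Exec P t t')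
    {s : List (ℕ × ℕ) × List Bool} (hs : toState s = t) :
    ∃ r, interpreter.Eval (2, P.rank) s r ∧ toState r.2 = t' := by
  have hbool : ∀ {b : BExp} {c : Bool} {t t' : State} {s : List (ℕ × ℕ) × List Bool},
      b.eval t = some (c, t') → toState s = t →
        ∃ s', interpreter.Eval (1, b.rank) s (c.toNat, s') ∧ toState s' = t' := by
    rintro b c t t' s hb rfl
    obtain ⟨hm, hr⟩ := (evaluates_bexp b).2 _ _ _ _ hb
    exact ⟨_, hr, by rw [toState, ← hm]⟩
  induction h generalizing s with
  | skip => exact ⟨(0, s), eval_skip_iff.2 rfl, hs⟩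
  | assign ha =>
    subst hs
    obtain ⟨hm, hr⟩ := (evaluates_aexp _).2 _ _ _ _ ha
    refine ⟨_, .node (first_assign _ _) hr (by rw [second_assign]; exact eval_skip_iff.2 rfl), ?_⟩
    rw [comb_assign, toState, look_cons, hm]
    rfl
  | @while_true b P _ _ _ _ hb _ _ ih₁ ih₂ =>
    obtain ⟨s₁, h₁, hs₁⟩ := hbool hb hs
    obtain ⟨r₂, h₂, hs₂⟩ := ih₁ hs₁
    obtain ⟨r₃, h₃, hs₃⟩ := ih₂ hs₂
    -- The evaluations of body and remaining loop are joined into one of the sequence to which the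
    -- interpreter unfolds the loop.
    have h₄ := Evaluator.Eval.node (first_seq P (.whileDo b P)) h₂ (by rwa [second_seq])
    refine ⟨_, .node (first_whileDo _ _) h₁ (by rw [second_whileDo]; exact h₄), ?_⟩
    rw [comb_snd (by rw [(rule_whileDo b P).1]; omega),
      comb_snd (by rw [(rule_seq _ _).1]; omega), hs₃]
  | @while_false b P _ _ hb =>
    obtain ⟨s₁, h₁, hs₁⟩ := hbool hb hs
    refine ⟨_, .node (first_whileDo _ _) h₁ (by
      rw [second_whileDo]
      exact eval_skip_iff.2 rfl), ?_⟩
    rw [comb_snd (by rw [(rule_whileDo b P).1]; omega), hs₁]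
  | @seq P Q _ _ _ _ _ ih₁ ih₂ =>
    obtain ⟨r₁, h₁, hs₁⟩ := ih₁ hs
    obtain ⟨r₂, h₂, hs₂⟩ := ih₂ hs₁
    refine ⟨_, .node (first_seq _ _) h₁ (by rw [second_seq]; exact h₂), ?_⟩
    rw [comb_snd (by rw [(rule_seq P Q).1]; omega), hs₂]
  | @ite_true b P Q _ _ _ hb _ ih =>
    obtain ⟨s₁, h₁, hs₁⟩ := hbool hb hs
    obtain ⟨r₂, h₂, hs₂⟩ := ih hs₁
    refine ⟨_, .node (first_ite _ _ _) h₁ (by rw [second_ite]; exact h₂), ?_⟩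
    rw [comb_snd (by rw [(rule_ite b P Q).1]; omega), hs₂]
  | @ite_false b P Q _ _ _ hb _ ih =>
    obtain ⟨s₁, h₁, hs₁⟩ := hbool hb hs
    obtain ⟨r₂, h₂, hs₂⟩ := ih hs₁
    refine ⟨_, .node (first_ite _ _ _) h₁ (by rw [second_ite]; exact h₂), ?_⟩
    rw [comb_snd (by rw [(rule_ite b P Q).1]; omega), hs₂]

/-! ### The machine is partial recursive -/

/-- This is course-of-values recursion: `l` lists the strings before the current one, its length is
the current index, and the required predecessor is the entry `(l.length - 1) / 2`. -/
theorem primrec_bstr : Primrec bstr := by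
  have hg : Primrec₂ fun (_ : Unit) (l : List (List Bool)) =>
      if l.length = 0 then some [] else (l[(l.length - 1) / 2]?).map fun u =>
        u ++ [decide ((l.length - 1) % 2 = 1)] := by
    have hl : Primrec fun p : Unit × List (List Bool) => p.2.length - 1 :=
      Primrec.pred.comp (Primrec.list_length.comp Primrec.snd)
    refine Primrec.ite (Primrec.eq.comp (Primrec.list_length.comp Primrec.snd) (Primrec.const 0))
      (Primrec.const (some [])) ?_
    refine Primrec.option_map (Primrec.list_getElem?.comp Primrec.snd
      (Primrec.nat_div.comp hl (Primrec.const 2))) ?_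
    exact Primrec.list_concat.comp Primrec.snd (Primrec.eq.decide.comp (Primrec.nat_mod.comp
      (hl.comp Primrec.fst) (Primrec.const 2)) (Primrec.const 1))
  refine (Primrec.nat_strong_rec (fun (_ : Unit) n => bstr n) hg fun _ n => ?_).comp
    (Primrec.const ()) Primrec.id
  rcases n with _ | n
  · simp [bstr]
  · have : n / 2 < n + 1 := by omega
    simp [bstr, this]

theorem primrec_twoPart : Primrec₂ twoPart := by
  have hs : Primrec selfDelim := by
    have h : Primrec fun n : ℕ =>
        (List.range (bstr n).length).map (fun _ => true) ++ false :: bstr n :=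
      Primrec.list_append.comp (Primrec.list_map
        (Primrec.list_range.comp (Primrec.list_length.comp primrec_bstr))
        (Primrec.const true).to₂) (Primrec.list_cons.comp (Primrec.const false) primrec_bstr)
    exact h.of_eq fun n => by simp [selfDelim, List.map_const']
  exact Primrec.list_append.comp (hs.comp Primrec.fst) Primrec.snd

/-- A number such that all later locations of the memory `look l` contain `0`. -/
def memBound (l : List (ℕ × ℕ)) : ℕ := l.foldr (fun p k => p.1 + 1 + k) 0

/-- The output for the memory `look l`. -/
def output (l : List (ℕ × ℕ)) : List Bool :=
  (List.range (memBound l)).flatMap fun i => bstr (look l i)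

theorem memOutput_output (l : List (ℕ × ℕ)) : MemOutput (look l) (output l) := by
  refine ⟨memBound l, fun i hi => ?_, rfl⟩
  induction l with
  | nil => rfl
  | cons p l ih =>
    simp only [memBound, List.foldr_cons] at hi ih
    rw [look_cons, Function.update_of_ne (by omega), ih (by omega)]

theorem primrec_output : Primrec output := by
  have hb : Primrec memBound :=
    Primrec.list_foldr (h := fun (_ : List (ℕ × ℕ)) (q : (ℕ × ℕ) × ℕ) => q.1.1 + 1 + q.2)
      Primrec.id (Primrec.const 0)
      (Primrec.nat_add.comp (Primrec.succ.comp (Primrec.fst.comp (Primrec.fst.comp Primrec.snd)))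
        (Primrec.snd.comp Primrec.snd))
  exact Primrec.list_flatMap (Primrec.list_range.comp hb) (primrec_bstr.comp primrec_look)

theorem rank_sentence (n : ℕ) : (sentence n).rank = n :=
  (Equiv.ofBijective Sentence.rank
    ⟨Sentence.rank_injective, Sentence.rank_surjective⟩).apply_symm_apply n

/-- The empty list of assignments represents the initial memory. Halting thereby becomes the
existence of a depth `k` for a computable test. -/
theorem outputs_sentence_iff {n : ℕ} {y x : List Bool} :
    (sentence n).Outputs y x ↔
      ∃ k v l, interpreter.evaln k (2, n) ([], y) = some (v, l, []) ∧ output l = x := by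
  have hnil : ∀ z, toState ([], z) = ⟨fun _ => 0, z⟩ := fun z => rfl
  constructor
  · rintro ⟨σ, he, ho⟩
    obtain ⟨⟨v, l, z⟩, hr, hs⟩ := exists_eval_of_exec he (hnil y)
    simp only [toState, State.mk.injEq] at hs
    obtain ⟨rfl, rfl⟩ := hs
    rw [rank_sentence] at hr
    obtain ⟨k, hk⟩ := Evaluator.eval_iff.1 hr
    exact ⟨k, v, l, hk, (memOutput_output l).unique ho⟩
  · rintro ⟨k, v, l, hk, rfl⟩
    have h := Evaluator.eval_iff.2 ⟨k, hk⟩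
    rw [← rank_sentence n] at h
    exact ⟨look l, exec_of_eval h, memOutput_output l⟩

/-- The program `p` is parsed by search: among all triples of `n`, `y` and a depth, one is sought
with `twoPart n y = p` for which the interpreter halts with all input read. `Outputs.unique` makes
the result independent of the triple found. -/
theorem partrec_machine : Partrec machine := by
  let T : List Bool → (ℕ × List Bool) × ℕ → Option (List Bool) := fun p i =>
    if twoPart i.1.1 i.1.2 = p then
      (interpreter.evaln i.2 (2, i.1.1) ([], i.1.2)).bind fun r =>
        if r.2.2 = [] then some (output r.2.1) else none
    else none
  have hmem : ∀ p x, (∃ i, T p i = some x) ↔ Outputs p x := by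
    intro p x
    constructor
    · rintro ⟨⟨⟨n, y⟩, k⟩, h⟩
      simp only [T, Option.ite_none_right_eq_some, Option.bind_eq_some_iff, Option.some.injEq] at h
      obtain ⟨rfl, ⟨v, l, z⟩, hk, rfl, hx⟩ := h
      exact ⟨n, y, rfl, outputs_sentence_iff.2 ⟨k, v, l, hk, hx⟩⟩
    · rintro ⟨n, y, rfl, h⟩
      obtain ⟨k, v, l, hk, hx⟩ := outputs_sentence_iff.1 h
      exact ⟨((n, y), k), by simp [T, hk, hx]⟩
  have hT : Computable₂ T := by
    have hn : Primrec fun q : List Bool × (ℕ × List Bool) × ℕ => q.2.1.1 :=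
      Primrec.fst.comp (Primrec.fst.comp Primrec.snd)
    have hy : Primrec fun q : List Bool × (ℕ × List Bool) × ℕ => q.2.1.2 :=
      Primrec.snd.comp (Primrec.fst.comp Primrec.snd)
    have hk : Primrec fun q : List Bool × (ℕ × List Bool) × ℕ => q.2.2 :=
      Primrec.snd.comp Primrec.snd
    have hc : Primrec fun q : List Bool × (ℕ × List Bool) × ℕ =>
        decide (twoPart q.2.1.1 q.2.1.2 = q.1) :=
      Primrec.eq.decide.comp (primrec_twoPart.comp hn hy) Primrec.fst
    have hi : Primrec fun q : List Bool × (ℕ × List Bool) × ℕ =>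
        (q.2.2, (2, q.2.1.1), (([] : List (ℕ × ℕ)), q.2.1.2)) :=
      hk.pair (((Primrec.const 2).pair hn).pair ((Primrec.const []).pair hy))
    have hr : Primrec fun r : ℕ × List (ℕ × ℕ) × List Bool =>
        if r.2.2 = [] then some (output r.2.1) else none :=
      Primrec.ite (Primrec.eq.comp (Primrec.snd.comp Primrec.snd) (Primrec.const []))
        (Primrec.option_some.comp (primrec_output.comp (Primrec.fst.comp Primrec.snd)))
        (Primrec.const none)
    have he := computable_interpreter.comp hi.to_comp
    exact (Computable.cond hc.to_comp
      (Computable.option_bind he (hr.to_comp.comp Computable.snd).to₂)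
      (Computable.const none)).of_eq fun q => Bool.cond_decide _ _ _
  obtain ⟨F, hF, h⟩ := exists_partrec_of_enum hT fun p i i' x x' hi hi' =>
    ((hmem p x).1 ⟨i, hi⟩).unique ((hmem p x').1 ⟨i', hi'⟩)
  exact hF.of_eq fun p => Part.ext fun x => by rw [h, hmem, mem_machine]

theorem isPrefixMachine_machine : IsPrefixMachine machine :=
  ⟨partrec_machine, machine_prefixFree⟩

/-- Every prefix machine is computed by a sentence of the enumeration. -/
theorem exists_run_eq {G : List Bool →. List Bool} (hG : IsPrefixMachine G) :
    ∃ n, ∀ y, (sentence n).run y = G y := by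
  obtain ⟨P, hP⟩ := exists_sentence hG
  refine ⟨sentence.symm P, fun y => Part.ext fun x => ?_⟩
  rw [Equiv.apply_symm_apply, Sentence.mem_run, hP]

end Imp2

theorem proposition1 :
    AdditivelyOptimal Imp2.machine {G | IsPrefixMachine G} ∧
      ∀ G : List Bool →. List Bool, IsPrefixMachine G →
        (∃ n : ℕ, ∀ y : List Bool,
          Imp2.machine (Imp2.twoPart n y) = (Imp2.sentence n).run y ∧
            (Imp2.sentence n).run y = G y) ∧
        ∀ n : ℕ, (∀ y : List Bool, (Imp2.sentence n).run y = G y) →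
          ∀ x : List Bool,
            complexity Imp2.machine x ≤
              complexity G x + (2 * (Imp2.bstr n).length + 1 : ℕ) := by
  refine ⟨⟨Imp2.isPrefixMachine_machine, fun G hG => ?_⟩, fun G hG => ⟨?_, fun n hn x =>
    Imp2.complexity_machine_le hn x⟩⟩
  · obtain ⟨n, hn⟩ := Imp2.exists_run_eq hG
    exact ⟨_, Imp2.complexity_machine_le hn⟩
  · obtain ⟨n, hn⟩ := Imp2.exists_run_eq hG
    exact ⟨n, fun y => ⟨Imp2.machine_twoPart n y, hn y⟩⟩
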